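/- **Setting.** Let $\gamma>1$. For $\mathbf U=(\rho,\mathbf m,E)\in\mathbb R\times\mathbb R^2\times\mathbb R$ put $\mathbf u=\mathbf m/\rho$, $e=\frac1\rho\big(E-\frac{\|\mathbf m\|^2}{2\rho}\big)$, $p=(\gamma-1)\rho e$, and let $G=\{\mathbf U:\rho>0,\ E-\frac{\|\mathbf m\|^2}{2\rho}>0\}$. Let $\mathbf F(\mathbf U)=(\rho\mathbf u,\ \rho\mathbf u\otimes\mathbf u+p\mathbf I,\ (E+p)\mathbf u)$. For a unit vector $\mathbf n$ let $\alpha_{\mathbf n}(\mathbf U)=|\mathbf u\cdot\mathbf n|+\sqrt{\gamma p/\rho}$, and let $\mathbf F^{hllc}(\mathbf U_L,\mathbf U_R;\mathbf n)$ be the two-dimensional HLLC flux with signal speeds $$S_L=\min_{\mathbf U\in\{\mathbf U_L,\mathbf U_R\}}\big(\mathbf u\cdot\mathbf n-\sqrt{\gamma p/\rho}\big),\qquad S_R=\max_{\mathbf U\in\{\mathbf U_L,\mathbf U_R\}}\big(\mathbf u\cdot\mathbf n+\sqrt{\gamma p/\rho}\big).$$ Let $\mathcal T_h$ be a partition of a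 domain $\Omega\subset\mathbb R^2$ into closed polygons $K$ of area $|K|$ (possibly unstructured; any two distinct edges meet at most in end points). For an edge $\mathscr E$ of $K$ let $|\mathscr E|$ be its length and $\mathbf n_{\mathscr E,K}$ the outward unit normal. Let $k\ge 0$, $N=k+1$, and let $\mathbb V_h^k$ be the space of functions that are, on each cell, polynomials of total degree at most $k$. Cell averages over $K$ are written $\overline{(\cdot)}_K$. Let $\mathbf x_{\mathscr E}^{(\mu)},\omega_\mu$ ($1\le\mu\le N$) be the $N$-point Gauss nodes and normalized weights on $\mathscr E$. On each $K$ let $\mathbf x_K^{(q)}\in K$, $\varpi_q\ge0$ ($1\le q\le Q$) be a quadrature with normalized weights that is exact for polynomials of degree at most $k$. Let $\rho^e_h,p^e_h\in\mathbb V_h^k$ be projections of $\rho^e,p^e$, where $\nabla p^e=-\rho^e\nabla\phi$ in $\Omega$, and let $\mathbf U_h=(\rho_h,\mathbf m_h,E_h)$ have all its components in $\mathbb V_h^k$. On the edges of $K$, "int" denotes the trace from $K$ and "ext" the trace from the cell on the other side. On boundary edges the exterior values of $\mathbf U_h$ and $p_h^e$ at the Gauss points are prescribed (boundary data), with the former in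 $G$ and the latter positive. A pair of subscripts $\mathscr E,\mu$ means evaluation at $\mathbf x_{\mathscr E}^{(\mu)}$. Put $$p^{e,\star}_{\mathscr E,\mu}=\tfrac12\big(p^{e,\rm int}_{\mathscr E,\mu}+p^{e,\rm ext}_{\mathscr E,\mu}\big),\qquad [\![p_h^e]\!]_{\mathscr E,\mu}=p^{e,\rm ext}_{\mathscr E,\mu}-p^{e,\rm int}_{\mathscr E,\mu},$$ $$\widehat{\mathbf F}_{\mathscr E,\mu}=\mathbf F^{hllc}\Big(\tfrac{p^{e,\star}_{\mathscr E,\mu}}{p^{e,\rm int}_{\mathscr E,\mu}}\mathbf U^{\rm int}_{\mathscr E,\mu},\tfrac{p^{e,\star}_{\mathscr E,\mu}}{p^{e,\rm ext}_{\mathscr E,\mu}}\mathbf U^{\rm ext}_{\mathscr E,\mu};\mathbf n_{\mathscr E,K}\Big).$$ The well-balanced DG scheme is, for all test polynomials $v$ of degree at most $k$ on $K$, $$\int_K(\mathbf U_h)_t v\,d\mathbf x=|K|\sum_q\varpi_q\mathbf F(\mathbf U_h(\mathbf x_K^{(q)}))\cdot\nabla v(\mathbf x_K^{(q)})+\big(0,\langle\mathbf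 S^{[2]},v\rangle_K,\langle S^{[3]},v\rangle_K\big)-\sum_{\mathscr E\subset\partial K}|\mathscr E|\sum_\mu\omega_\mu\widehat{\mathbf F}_{\mathscr E,\mu}\,v(\mathbf x_{\mathscr E}^{(\mu)}).$$ Here, with $\mathbf B_K(v)=\sum_{\mathscr E}|\mathscr E|\sum_\mu\omega_\mu p^{e,\star}_{\mathscr E,\mu}v(\mathbf x_{\mathscr E}^{(\mu)})\mathbf n_{\mathscr E,K}-|K|\sum_q\varpi_q p_h^e(\mathbf x_K^{(q)})\nabla v(\mathbf x_K^{(q)})$, $$\langle\mathbf S^{[2]},v\rangle_K=|K|\sum_q\varpi_q\Big(\frac{\rho_h}{\rho_h^e}(\mathbf x_K^{(q)})-\frac{\overline{(\rho_h)}_K}{\overline{(\rho_h^e)}_K}\Big)(\nabla p_h^e\,v)(\mathbf x_K^{(q)})+\frac{\overline{(\rho_h)}_K}{\overline{(\rho_h^e)}_K}\mathbf B_K(v),$$ $$\langle S^{[3]},v\rangle_K=|K|\sum_q\varpi_q\Big(\frac{\mathbf m_h}{\rho_h^e}(\mathbf x_K^{(q)})-\frac{\overline{(\mathbf m_h)}_K}{\overline{(\rho_h^e)}_K}\Big)\cdot(\nabla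 p_h^e\,v)(\mathbf x_K^{(q)})+\frac{\overline{(\mathbf m_h)}_K}{\overline{(\rho_h^e)}_K}\cdot\mathbf B_K(v).$$ Let $\mathbf L_K(\mathbf U_h)$ be $\frac1{|K|}$ times the right-hand side of the scheme with $v=1$, so that $\frac{d}{dt}\overline{\mathbf U}_K=\mathbf L_K(\mathbf U_h)$. Suppose that on each cell $K$ there is a quadrature with positive weights $$\frac1{|K|}\int_K u\,d\mathbf x=\sum_{\mathscr E\subset\partial K}\sum_{\mu=1}^N\widehat\varpi_{\mathscr E}^{(\mu)}u(\mathbf x_{\mathscr E}^{(\mu)})+\sum_{q=1}^{\widetilde Q}\widetilde\varpi_q u(\widetilde{\mathbf x}_K^{(q)}),\qquad \widetilde{\mathbf x}_K^{(q)}\in K,$$ that is exact for all polynomials $u$ of degree at most $k$. Put $\mathbb S_K=\{\mathbf x_{\mathscr E}^{(\mu)}\}\cup\{\widetilde{\mathbf x}_K^{(q)}\}\cup\{\mathbf x_K^{(q)}\}$. **Theorem.** Assume that for all $K\in\mathcal T_h$ and $\mathbf x\in\mathbb S_K$ (values taken from $K$) one has $\rho_h^e(\mathbf x)>0$, $p_h^e(\mathbf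 x)>0$ and $\mathbf U_h(\mathbf x)\in G$. Let $\Delta t>0$ satisfy, for all $K\in\mathcal T_h$, all edges $\mathscr E$ of $K$ and all $1\le\mu\le N$, $$\Delta t\left(\widetilde\alpha_K^F\frac{2|\mathscr E|\,p^{e,\star}_{\mathscr E,\mu}}{|K|\,p^{e,\rm int}_{\mathscr E,\mu}}+\widetilde\alpha_K^S\frac{\widehat\varpi_{\mathscr E}^{(\mu)}}{\omega_\mu}\right)\le\frac{\widehat\varpi_{\mathscr E}^{(\mu)}}{\omega_\mu},$$ where $$\widetilde\alpha_K^F=\max_{\mathscr E\subset\partial K,\,1\le\mu\le N}\max\big\{\alpha_{\mathbf n_{\mathscr E,K}}(\mathbf U^{\rm int}_{\mathscr E,\mu}),\alpha_{\mathbf n_{\mathscr E,K}}(\mathbf U^{\rm ext}_{\mathscr E,\mu})\big\},$$ $$\widetilde\alpha_K^S=\max_{1\le q\le Q}\frac{\|\nabla p_h^e(\mathbf x_K^{(q)})\|}{\rho_h^e(\mathbf x_K^{(q)})\sqrt{2e_h(\mathbf x_K^{(q)})}}+\frac{\big\|\sum_{\mathscr E\subset\partial K}|\mathscr E|\sum_{\mu}\omega_\mu[\![p_h^e]\!]_{\mathscr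 E,\mu}\,\mathbf n_{\mathscr E,K}\big\|}{2|K|\,\overline{(\rho_h^e)}_K\sqrt{2\overline e_K}},$$ and $e_h(\mathbf x)$, $\overline e_K$ are the specific internal energies $e$ of the states $\mathbf U_h(\mathbf x)$ and $\overline{\mathbf U}_K$. Then $\overline{\mathbf U}_K+\Delta t\,\mathbf L_K(\mathbf U_h)\in G$ for all $K\in\mathcal T_h$. -/

import Mathlib

open MeasureTheory Topology
open scoped RealInnerProductSpace

noncomputable section

/-! ## Physical states, fluxes and the HLLC flux -/

/-- The plane `ℝ²` with its Euclidean norm. -/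
abbrev Plane := EuclideanSpace ℝ (Fin 2)

/-- Conservative variables `U = (ρ, m, E)`. -/
abbrev State := ℝ × Plane × ℝ

namespace Euler

/-- Density `ρ`. -/
def density (U : State) : ℝ := U.1

/-- Momentum `m`. -/
def momentum (U : State) : Plane := U.2.1

/-- Total non-gravitational energy `E`. -/
def energy (U : State) : ℝ := U.2.2

/-- `𝒢(U) = E - ‖m‖² / (2ρ)`, which is `ρ e`. -/
def internalEnergy (U : State) : ℝ :=
  energy U - ‖momentum U‖ ^ 2 / (2 * density U)

/-- The set `G` of physically admissible states. -/
def G : Set State := {U | 0 < density U ∧ 0 < internalEnergy U}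

/-- Velocity `u = m / ρ`. -/
def velocity (U : State) : Plane := (density U)⁻¹ • momentum U

/-- Specific internal energy `e`. -/
def specificEnergy (U : State) : ℝ := internalEnergy U / density U

/-- Pressure of an ideal gas with adiabatic index `γ`. -/
def pressure (γ : ℝ) (U : State) : ℝ := (γ - 1) * internalEnergy U

/-- Sound speed `√(γ p / ρ)`. -/
def soundSpeed (γ : ℝ) (U : State) : ℝ := √(γ * pressure γ U / density U)

/-- `F(U) · w`, where the momentum rows of `F(U)` are `ρ u ⊗ u + p I`. -/
def flux (γ : ℝ) (U : State) (w : Plane) : State :=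
  (density U * ⟪velocity U, w⟫,
    (density U * ⟪velocity U, w⟫) • velocity U + pressure γ U • w,
    (energy U + pressure γ U) * ⟪velocity U, w⟫)

/-- `α_n(U) = |u · n| + √(γ p / ρ)`. -/
def alpha (γ : ℝ) (n : Plane) (U : State) : ℝ :=
  |⟪velocity U, n⟫| + soundSpeed γ U

/-- Left signal speed `S_L = min {(u·n - c)(U_L), (u·n - c)(U_R)}`. -/
def speedL (γ : ℝ) (UL UR : State) (n : Plane) : ℝ :=
  min (⟪velocity UL, n⟫ - soundSpeed γ UL) (⟪velocity UR, n⟫ - soundSpeed γ UR)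

/-- Right signal speed `S_R = max {(u·n + c)(U_L), (u·n + c)(U_R)}`. -/
def speedR (γ : ℝ) (UL UR : State) (n : Plane) : ℝ :=
  max (⟪velocity UL, n⟫ + soundSpeed γ UL) (⟪velocity UR, n⟫ + soundSpeed γ UR)

/-- Middle wave speed `S_*`. -/
def speedStar (γ : ℝ) (UL UR : State) (n : Plane) : ℝ :=
  let SL := speedL γ UL UR n
  let SR := speedR γ UL UR n
  let qL := ⟪velocity UL, n⟫
  let qR := ⟪velocity UR, n⟫
  (pressure γ UR - pressure γ UL
      + density UL * qL * (SL - qL) - density UR * qR * (SR - qR)) /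
    (density UL * (SL - qL) - density UR * (SR - qR))

/-- Intermediate state `U_{*i}` built from `U = U_i`, `S = S_i` and `Sstar = S_*`; the tangential
velocity of `U` is kept and its normal velocity is replaced by `Sstar`. -/
def starState (γ : ℝ) (U : State) (S Sstar : ℝ) (n : Plane) : State :=
  let q := ⟪velocity U, n⟫
  (density U * ((S - q) / (S - Sstar))) •
    ((1, velocity U + (Sstar - q) • n,
      energy U / density U
        + (Sstar - q) * (Sstar + pressure γ U / (density U * (S - q)))) : State)

/-- Intermediate flux `F_{*i} = F(U_i)·n + S_i (U_{*i} - U_i)`. -/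
def starFlux (γ : ℝ) (U : State) (S Sstar : ℝ) (n : Plane) : State :=
  flux γ U n + S • (starState γ U S Sstar n - U)

/-- The two-dimensional HLLC flux `F^hllc(U_L, U_R; n)`. -/
def hllc (γ : ℝ) (UL UR : State) (n : Plane) : State :=
  if 0 ≤ speedL γ UL UR n then flux γ UL n
  else if 0 ≤ speedStar γ UL UR n then
    starFlux γ UL (speedL γ UL UR n) (speedStar γ UL UR n) n
  else if 0 ≤ speedR γ UL UR n then
    starFlux γ UR (speedR γ UL UR n) (speedStar γ UL UR n) n
  else flux γ UR n

/-- `ρ`, `p` (with zero velocity) form a stationary hydrostatic solution on `Ω` for the potential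
`φ`: `∇p = -ρ ∇φ`. -/
def IsHydrostatic (Ω : Set Plane) (φ ρ p : Plane → ℝ) : Prop :=
  ∀ x ∈ Ω, DifferentiableAt ℝ φ x ∧ DifferentiableAt ℝ p x ∧
    gradient p x = -(ρ x • gradient φ x)

end Euler

/-! ## Polygonal meshes -/

/-- `n` is the unit normal, outward with respect to `K`, along the edge `[a, b]` of `K`: near each
relatively interior point `x` of the edge, `K` is the half-plane `{y | (y - x) · n ≤ 0}`. -/
def IsOutwardNormal (K : Set Plane) (a b n : Plane) : Prop :=
  ‖n‖ = 1 ∧ ∀ x ∈ openSegment ℝ a b, ∀ᶠ y in 𝓝 x, (y ∈ K ↔ ⟪y - x, n⟫ ≤ 0)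

/-- A partition of the domain `Ω` into closed polygons `cell K`, `K : C`, with straight edges
`[src e, tgt e]`, `e : E`. The cells need be neither convex nor simply connected, and may have any
number of edges (collinear adjacent edges are allowed); edges meet only in their end points. -/
structure PolygonalMesh (Ω : Set Plane) (C E : Type*) where
  isOpen_domain : IsOpen Ω
  /-- The two end points of an edge, in an order that does not depend on a cell. -/
  src : E → Plane
  tgt : E → Plane
  src_ne_tgt : ∀ e, src e ≠ tgt e
  disjoint_edges : ∀ e e', e ≠ e' →
    Disjoint (openSegment ℝ (src e) (tgt e)) (segment ℝ (src e') (tgt e'))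
  /-- The closed cell `K`. -/
  cell : C → Set Plane
  isCompact_cell : ∀ K, IsCompact (cell K)
  isConnected_interior : ∀ K, IsConnected (interior (cell K))
  /-- The edges of `K`. -/
  edges : C → Finset E
  frontier_cell : ∀ K, frontier (cell K) = ⋃ e ∈ edges K, segment ℝ (src e) (tgt e)
  /-- The outward unit normal `n_{e,K}`. -/
  normal : C → E → Plane
  isOutwardNormal : ∀ K, ∀ e ∈ edges K, IsOutwardNormal (cell K) (src e) (tgt e) (normal K e)
  disjoint_interior : ∀ K K', K ≠ K' → Disjoint (interior (cell K)) (interior (cell K'))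
  iUnion_cell : ⋃ K, cell K = closure Ω

/-! ## Quadrature rules -/

/-- `p(x)` for a polynomial `p` in two variables. -/
def evalAt (p : MvPolynomial (Fin 2) ℝ) (x : Plane) : ℝ := MvPolynomial.eval (fun i => x i) p

/-- `∇p(x)` for a polynomial `p` in two variables. -/
def gradAt (p : MvPolynomial (Fin 2) ℝ) (x : Plane) : Plane :=
  !₂[evalAt (MvPolynomial.pderiv 0 p) x, evalAt (MvPolynomial.pderiv 1 p) x]

/-- The `N`-point Gauss quadrature on `[0, 1]`, with normalized weights: the `N`-point rule that is
exact for polynomials of degree at most `2N - 1`. Exactness determines it up to the numbering of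
the nodes: they are the `N` distinct zeros of the shifted Legendre polynomial. -/
structure GaussRule (N : ℕ) where
  node : Fin N → ℝ
  weight : Fin N → ℝ
  exact : ∀ p : Polynomial ℝ, p.natDegree < 2 * N →
    ∑ μ, weight μ * p.eval (node μ) = ∫ s in (0 : ℝ)..1, p.eval s

/-- A quadrature rule on a cell with nonnegative, normalized weights that is exact for polynomials
of total degree at most `k`. -/
structure CellQuadrature (K : Set Plane) (k : ℕ) where
  size : ℕ
  node : Fin size → Plane
  weight : Fin size → ℝ
  node_mem : ∀ q, node q ∈ K
  weight_nonneg : ∀ q, 0 ≤ weight q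
  exact : ∀ p : MvPolynomial (Fin 2) ℝ, p.totalDegree ≤ k →
    ∑ q, weight q * evalAt p (node q) = ⨍ x in K, evalAt p x

namespace PolygonalMesh

variable {Ω : Set Plane} {C E : Type*} (T : PolygonalMesh Ω C E)

/-- The area `|K|`. -/
def area (K : C) : ℝ := volume.real (T.cell K)

/-- The length `|e|` of an edge. -/
def edgeLength (e : E) : ℝ := dist (T.src e) (T.tgt e)

/-- The Gauss point `x_e^{(μ)}` on the edge `e`. -/
def gaussPoint {N : ℕ} (g : GaussRule N) (e : E) (μ : Fin N) : Plane :=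
  T.src e + g.node μ • (T.tgt e - T.src e)

open Classical in
/-- The cell on the other side of the edge `e` of `K`, or `none` if `e` lies on the boundary of the
domain. -/
def neighbour (K : C) (e : E) : Option C :=
  if h : ∃ K', K' ≠ K ∧ e ∈ T.edges K' then some h.choose else none

/-- The special quadrature on the cell `K`: all weights are positive, the nodes are all the Gauss
points on all the edges of `K` together with finitely many further points of `K`, and the rule is
exact for polynomials of total degree at most `k`. -/
structure SpecialQuadrature {N : ℕ} (g : GaussRule N) (k : ℕ) (K : C) where
  edgeWeight : E → Fin N → ℝ
  size : ℕ
  node : Fin size → Plane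
  weight : Fin size → ℝ
  node_mem : ∀ q, node q ∈ T.cell K
  edgeWeight_pos : ∀ e ∈ T.edges K, ∀ μ, 0 < edgeWeight e μ
  weight_pos : ∀ q, 0 < weight q
  exact : ∀ p : MvPolynomial (Fin 2) ℝ, p.totalDegree ≤ k →
    ∑ e ∈ T.edges K, ∑ μ, edgeWeight e μ * evalAt p (T.gaussPoint g e μ)
      + ∑ q, weight q * evalAt p (node q) = ⨍ x in T.cell K, evalAt p x

end PolygonalMesh

/-! ## The discontinuous Galerkin space -/

/-- The space `𝕍_h^k` of discontinuous piecewise polynomials: one polynomial of total degree at most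
`k` on each cell. -/
abbrev DGSpace (C : Type*) (k : ℕ) := C → MvPolynomial.restrictTotalDegree (Fin 2) ℝ k

namespace DGSpace

variable {C : Type*} {k : ℕ}

/-- The value at `x` of the polynomial on the cell `K` (for `x` on an edge of `K`: the trace taken
from the interior of `K`). -/
def val (u : DGSpace C k) (K : C) (x : Plane) : ℝ := evalAt (u K) x

/-- The gradient at `x` of the polynomial on the cell `K`. -/
def grad (u : DGSpace C k) (K : C) (x : Plane) : Plane := gradAt (u K) x

/-- The cell average over `K`. -/
def avg {Ω : Set Plane} {E : Type*} (T : PolygonalMesh Ω C E) (u : DGSpace C k) (K : C) : ℝ :=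
  ⨍ x in T.cell K, u.val K x

end DGSpace

/-- `P` is a projection of functions onto `𝕍_h^k`: it has values in `𝕍_h^k`, and it reproduces each
function that coincides with an element of `𝕍_h^k` inside the cells. -/
def PolygonalMesh.IsProjection {Ω : Set Plane} {C E : Type*} (T : PolygonalMesh Ω C E) {k : ℕ}
    (P : (Plane → ℝ) → DGSpace C k) : Prop :=
  ∀ (u : Plane → ℝ) (w : DGSpace C k),
    (∀ K, ∀ x ∈ interior (T.cell K), u x = w.val K x) → P u = w

/-- A numerical solution `U_h`, all of whose components belong to `𝕍_h^k`. -/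
structure DGState (C : Type*) (k : ℕ) where
  density : DGSpace C k
  momentum : Fin 2 → DGSpace C k
  energy : DGSpace C k

namespace DGState

variable {C : Type*} {k : ℕ}

/-- `U_h(x)`, computed from the polynomials on the cell `K`. -/
def val (U : DGState C k) (K : C) (x : Plane) : State :=
  (U.density.val K x, !₂[(U.momentum 0).val K x, (U.momentum 1).val K x], U.energy.val K x)

/-- The cell average of `U_h` over `K`. -/
def avg {Ω : Set Plane} {E : Type*} (T : PolygonalMesh Ω C E) (U : DGState C k) (K : C) : State :=
  (U.density.avg T K, !₂[(U.momentum 0).avg T K, (U.momentum 1).avg T K], U.energy.avg T K)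

end DGState

/-! ## The well-balanced scheme -/

/-- The data of the well-balanced DG scheme of degree `k` on the mesh `T`. -/
structure WBScheme {Ω : Set Plane} {C E : Type*} (T : PolygonalMesh Ω C E) (k : ℕ) where
  /-- The adiabatic index. -/
  γ : ℝ
  /-- The Gauss rule, with `k + 1` points, on the edges. -/
  gauss : GaussRule (k + 1)
  /-- The quadrature on the cells. -/
  quad : ∀ K, CellQuadrature (T.cell K) k
  /-- The projected equilibrium density `ρ_h^e`. -/
  ρe : DGSpace C k
  /-- The projected equilibrium pressure `p_h^e`. -/
  pe : DGSpace C k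
  /-- Exterior values of `p_h^e` at the Gauss points of boundary edges. -/
  peBdry : E → Fin (k + 1) → ℝ

namespace WBScheme

open Euler

variable {Ω : Set Plane} {C E : Type*} {T : PolygonalMesh Ω C E} {k : ℕ}

/-- `p^{e,int(K)}` at the `μ`-th Gauss point of `e`. -/
def peInt (S : WBScheme T k) (K : C) (e : E) (μ : Fin (k + 1)) : ℝ :=
  S.pe.val K (T.gaussPoint S.gauss e μ)

/-- `p^{e,ext(K)}` at the `μ`-th Gauss point of `e`. -/
def peExt (S : WBScheme T k) (K : C) (e : E) (μ : Fin (k + 1)) : ℝ :=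
  match T.neighbour K e with
  | some K' => S.pe.val K' (T.gaussPoint S.gauss e μ)
  | none => S.peBdry e μ

/-- `p^{e,⋆} = (p^{e,int(K)} + p^{e,ext(K)}) / 2`. -/
def peStar (S : WBScheme T k) (K : C) (e : E) (μ : Fin (k + 1)) : ℝ :=
  (S.peInt K e μ + S.peExt K e μ) / 2

/-- The jump `p^{e,ext(K)} - p^{e,int(K)}`. -/
def peJump (S : WBScheme T k) (K : C) (e : E) (μ : Fin (k + 1)) : ℝ :=
  S.peExt K e μ - S.peInt K e μ

/-- `U_h^{int(K)}` at the `μ`-th Gauss point of `e`. -/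
def UInt (S : WBScheme T k) (U : DGState C k) (K : C) (e : E) (μ : Fin (k + 1)) : State :=
  U.val K (T.gaussPoint S.gauss e μ)

/-- `U_h^{ext(K)}` at the `μ`-th Gauss point of `e`; `UBdry` gives the exterior states on boundary
edges. -/
def UExt (S : WBScheme T k) (U : DGState C k) (UBdry : E → Fin (k + 1) → State)
    (K : C) (e : E) (μ : Fin (k + 1)) : State :=
  match T.neighbour K e with
  | some K' => U.val K' (T.gaussPoint S.gauss e μ)
  | none => UBdry e μ

/-- The modified HLLC flux at the `μ`-th Gauss point of the edge `e` of `K`. -/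
def numFlux (S : WBScheme T k) (U : DGState C k) (UBdry : E → Fin (k + 1) → State)
    (K : C) (e : E) (μ : Fin (k + 1)) : State :=
  hllc S.γ ((S.peStar K e μ / S.peInt K e μ) • S.UInt U K e μ)
    ((S.peStar K e μ / S.peExt K e μ) • S.UExt U UBdry K e μ) (T.normal K e)

/-- The bracket `∑_e |e| ∑_μ ω_μ p^{e,⋆} v n - |K| ∑_q ϖ_q p_h^e ∇v` of the source terms. -/
def sourceBracket (S : WBScheme T k) (K : C) (v : MvPolynomial (Fin 2) ℝ) : Plane :=
  ∑ e ∈ T.edges K, T.edgeLength e • ∑ μ,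
      (S.gauss.weight μ * S.peStar K e μ * evalAt v (T.gaussPoint S.gauss e μ)) • T.normal K e
    - T.area K • ∑ q, ((S.quad K).weight q * S.pe.val K ((S.quad K).node q)) •
        gradAt v ((S.quad K).node q)

/-- The approximation `⟨S^[2], v⟩_K` of the momentum source term. -/
def sourceMomentum (S : WBScheme T k) (U : DGState C k) (K : C)
    (v : MvPolynomial (Fin 2) ℝ) : Plane :=
  T.area K • ∑ q, ((S.quad K).weight q *
      (density (U.val K ((S.quad K).node q)) / S.ρe.val K ((S.quad K).node q)
        - density (U.avg T K) / S.ρe.avg T K) *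
      evalAt v ((S.quad K).node q)) • S.pe.grad K ((S.quad K).node q)
    + (density (U.avg T K) / S.ρe.avg T K) • S.sourceBracket K v

/-- The approximation `⟨S^[3], v⟩_K` of the energy source term. -/
def sourceEnergy (S : WBScheme T k) (U : DGState C k) (K : C)
    (v : MvPolynomial (Fin 2) ℝ) : ℝ :=
  T.area K * ∑ q, (S.quad K).weight q *
      ⟪(S.ρe.val K ((S.quad K).node q))⁻¹ • momentum (U.val K ((S.quad K).node q))
        - (S.ρe.avg T K)⁻¹ • momentum (U.avg T K), S.pe.grad K ((S.quad K).node q)⟫ *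
      evalAt v ((S.quad K).node q)
    + ⟪(S.ρe.avg T K)⁻¹ • momentum (U.avg T K), S.sourceBracket K v⟫

/-- The right-hand side of the well-balanced DG scheme `∫_K (U_h)_t v = …` on the cell `K` for the
test function `v`. -/
def rhs (S : WBScheme T k) (U : DGState C k) (UBdry : E → Fin (k + 1) → State) (K : C)
    (v : MvPolynomial (Fin 2) ℝ) : State :=
  T.area K • ∑ q, (S.quad K).weight q •
      flux S.γ (U.val K ((S.quad K).node q)) (gradAt v ((S.quad K).node q))
    + (0, S.sourceMomentum U K v, S.sourceEnergy U K v)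
    - ∑ e ∈ T.edges K, T.edgeLength e • ∑ μ,
        (S.gauss.weight μ * evalAt v (T.gaussPoint S.gauss e μ)) • S.numFlux U UBdry K e μ

/-- `L_K(U_h)`: the scheme with the test function `v = 1`, divided by `|K|`; thus the cell averages
evolve by `d/dt avg_K(U_h) = L_K(U_h)`. -/
def L (S : WBScheme T k) (U : DGState C k) (UBdry : E → Fin (k + 1) → State) (K : C) : State :=
  (T.area K)⁻¹ • S.rhs U UBdry K 1

/-- The point set `𝕊_K`: the Gauss points on the edges of `K`, the other nodes of the special
quadrature, and the nodes of the quadrature used in the scheme. -/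
def pointSet (S : WBScheme T k) {K : C} (Q : T.SpecialQuadrature S.gauss k K) : Set Plane :=
  {x | ∃ e ∈ T.edges K, ∃ μ, x = T.gaussPoint S.gauss e μ} ∪ Set.range Q.node ∪
    Set.range (S.quad K).node

/-- The flux-speed bound `α̃_K^F`. -/
def alphaF (S : WBScheme T k) (U : DGState C k) (UBdry : E → Fin (k + 1) → State) (K : C) : ℝ :=
  max (⨆ i : T.edges K × Fin (k + 1), alpha S.γ (T.normal K i.1) (S.UInt U K i.1 i.2))
    (⨆ i : T.edges K × Fin (k + 1), alpha S.γ (T.normal K i.1) (S.UExt U UBdry K i.1 i.2))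

/-- `α̃_K^{S,1}`. -/
def alphaS1 (S : WBScheme T k) (U : DGState C k) (K : C) : ℝ :=
  ⨆ q, ‖S.pe.grad K ((S.quad K).node q)‖ /
    (S.ρe.val K ((S.quad K).node q) * √(2 * specificEnergy (U.val K ((S.quad K).node q))))

/-- `α̃_K^{S,2}`. -/
def alphaS2 (S : WBScheme T k) (U : DGState C k) (K : C) : ℝ :=
  ‖∑ e ∈ T.edges K, (T.edgeLength e * ∑ μ, S.gauss.weight μ * S.peJump K e μ) • T.normal K e‖ /
    (2 * T.area K * S.ρe.avg T K * √(2 * specificEnergy (U.avg T K)))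

/-- The source bound `α̃_K^S`. -/
def alphaS (S : WBScheme T k) (U : DGState C k) (K : C) : ℝ := S.alphaS1 U K + S.alphaS2 U K

end WBScheme

end

open MeasureTheory Topology
open scoped RealInnerProductSpace

noncomputable section

/-! ### Primitive variables. -/

namespace Euler

/-! `G` is a convex cone cut out by strict linear inequalities (`mem_G_iff`): positive density, and
`E - m·v + ρ‖v‖²/2 > 0` for every velocity `v`. Relaxing them to weak inequalities gives
`closedCone`, and `G + closedCone ⊆ G`. It is therefore enough to write the updated average as a sum
of pieces in `closedCone`, at least one of which lies in `G`.

The average is shared out as `(1 - Δt α^S) Ū + Δt α^{S,1} Ū + Δt α^{S,2} Ū`, and each share pays for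
one part of the update.

Fluxes: the special quadrature expands the first share into nodal states with positive weights. The
state at each edge Gauss point absorbs the numerical flux at that same point, because `2α U_L -
F^hllc ∈ G` (`smul_sub_hllc_mem_G`); no cancellation between edges is needed. This is applied to
`(p⋆/p) U`, which has the same wave speeds as `U`, and the CFL condition says exactly that the
weight of the node is large enough.

Sources: tested with `v = 1`, the pressure bracket splits through `p⋆ = p^int + jump/2`. The
interior traces turn into the volume sum of `∇p_h^e` by the divergence theorem, made discrete by the
two quadrature rules (`PolygonalMesh.area_smul_sum_gradAt`), and cancel the mean-ratio corrections.
What remains are accelerations `(0, ρa, m·a)` of nodal states and of the mean (`source_one`). A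
multiple `α ≥ ‖a‖/√(2e)` of the accelerated state compensates such a term
(`smul_add_accelerate_mem_closedCone`), which is where both parts of `α^S` come from. -/

/-- The state with density `ρ`, velocity `u` and specific internal energy `e`. -/
def primState (ρ : ℝ) (u : Plane) (e : ℝ) : State := (ρ, ρ • u, ρ * (e + ‖u‖ ^ 2 / 2))

section prim

variable {γ ρ e : ℝ} {u n : Plane}

theorem density_primState : density (primState ρ u e) = ρ := rfl

theorem momentum_primState : momentum (primState ρ u e) = ρ • u := rfl

theorem energy_primState : energy (primState ρ u e) = ρ * (e + ‖u‖ ^ 2 / 2) := rfl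

theorem velocity_primState (hρ : ρ ≠ 0) : velocity (primState ρ u e) = u := by
  simp [velocity, density_primState, momentum_primState, smul_smul, hρ]

theorem internalEnergy_primState (hρ : ρ ≠ 0) : internalEnergy (primState ρ u e) = ρ * e := by
  simp only [internalEnergy, density_primState, momentum_primState, energy_primState, norm_smul,
    mul_pow, Real.norm_eq_abs, sq_abs]
  field_simp
  ring

theorem specificEnergy_primState (hρ : ρ ≠ 0) : specificEnergy (primState ρ u e) = e := by
  rw [specificEnergy, internalEnergy_primState hρ, density_primState]
  field_simp

theorem pressure_primState (hρ : ρ ≠ 0) :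
    pressure γ (primState ρ u e) = (γ - 1) * (ρ * e) := by
  rw [pressure, internalEnergy_primState hρ]

theorem soundSpeed_primState (hρ : ρ ≠ 0) :
    soundSpeed γ (primState ρ u e) = √(γ * (γ - 1) * e) := by
  rw [soundSpeed, pressure_primState hρ, density_primState]
  congr 1
  field_simp

theorem smul_primState (c : ℝ) : c • primState ρ u e = primState (c * ρ) u e := by
  simp [primState, smul_smul, mul_assoc]

theorem primState_mem_G (hρ : 0 < ρ) (he : 0 < e) : primState ρ u e ∈ G :=
  ⟨hρ, by rw [internalEnergy_primState hρ.ne']; positivity⟩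

theorem alpha_primState (hρ : ρ ≠ 0) :
    alpha γ n (primState ρ u e) = |⟪u, n⟫| + √(γ * (γ - 1) * e) := by
  rw [alpha, velocity_primState hρ, soundSpeed_primState hρ]

end prim

theorem exists_primState {U : State} (hU : U ∈ G) :
    ∃ ρ u e, 0 < ρ ∧ 0 < e ∧ U = primState ρ u e := by
  obtain ⟨r, m, E⟩ := U
  obtain ⟨h1, h2⟩ := hU
  simp only [density, internalEnergy, momentum, energy] at h1 h2
  refine ⟨r, r⁻¹ • m, (E - ‖m‖ ^ 2 / (2 * r)) / r, h1, by positivity, ?_⟩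
  have h := h1.ne'
  simp only [primState, smul_smul, mul_inv_cancel₀ h, one_smul, norm_smul, mul_pow, norm_inv,
    Real.norm_eq_abs, inv_pow, sq_abs, Prod.mk.injEq, true_and]
  field_simp
  ring

/-! ### Linear description of `G` and its closed cone. -/

/-- The linear functional `E - m · v + ρ ‖v‖² / 2`; on states of positive density its minimum over
`v` is `ρ e`. -/
def shiftedEnergy (v : Plane) (U : State) : ℝ :=
  energy U - ⟪momentum U, v⟫ + density U * (‖v‖ ^ 2 / 2)

section shifted

variable (v : Plane)

theorem density_add (U V : State) : density (U + V) = density U + density V := rfl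

theorem density_smul (c : ℝ) (U : State) : density (c • U) = c * density U := rfl

theorem shiftedEnergy_add (U V : State) :
    shiftedEnergy v (U + V) = shiftedEnergy v U + shiftedEnergy v V := by
  simp only [shiftedEnergy, energy, momentum, density, Prod.fst_add, Prod.snd_add, inner_add_left]
  ring

theorem shiftedEnergy_smul (c : ℝ) (U : State) :
    shiftedEnergy v (c • U) = c * shiftedEnergy v U := by
  simp only [shiftedEnergy, energy, momentum, density, Prod.smul_fst, Prod.smul_snd,
    real_inner_smul_left, smul_eq_mul]
  ring

theorem shiftedEnergy_primState (ρ : ℝ) (u : Plane) (e : ℝ) :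
    shiftedEnergy v (primState ρ u e) = ρ * (e + ‖u - v‖ ^ 2 / 2) := by
  simp only [shiftedEnergy, energy_primState, momentum_primState, density_primState,
    real_inner_smul_left, norm_sub_sq_real]
  ring

end shifted

/-- The functional equals `ρe + ρ‖u - v‖²/2`, so the choice `v = u` recovers the nonlinear
condition. The gain is linearity in `U`: sums and fluxes can be tested one `v` at a time. -/
theorem mem_G_iff {U : State} : U ∈ G ↔ 0 < density U ∧ ∀ v, 0 < shiftedEnergy v U := by
  constructor
  · intro hU
    obtain ⟨ρ, u, e, hρ, he, rfl⟩ := exists_primState hU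
    refine ⟨hρ, fun v => ?_⟩
    rw [shiftedEnergy_primState]
    positivity
  · rintro ⟨h1, h2⟩
    refine ⟨h1, ?_⟩
    have := h2 (velocity U)
    have hd := h1.ne'
    simp only [shiftedEnergy, velocity, real_inner_smul_right, real_inner_self_eq_norm_sq,
      norm_smul, norm_inv, Real.norm_eq_abs, mul_pow, inv_pow, sq_abs] at this
    convert this using 1
    rw [internalEnergy]
    field_simp
    ring

/-- The closed convex cone of states of nonnegative density and internal energy. -/
def closedCone : Set State := {U | 0 ≤ density U ∧ ∀ v, 0 ≤ shiftedEnergy v U}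

theorem G_subset_closedCone : G ⊆ closedCone := fun _ hU =>
  ⟨(mem_G_iff.1 hU).1.le, fun v => ((mem_G_iff.1 hU).2 v).le⟩

/-- Strictness is needed from one summand only, so all other contributions may have zero weight or
be degenerate. -/
theorem add_mem_G {U V : State} (hU : U ∈ G) (hV : V ∈ closedCone) : U + V ∈ G := by
  rw [mem_G_iff] at hU ⊢
  refine ⟨?_, fun v => ?_⟩
  · rw [density_add]; linarith [hU.1, hV.1]
  · rw [shiftedEnergy_add]; linarith [hU.2 v, hV.2 v]

theorem smul_mem_G {c : ℝ} (hc : 0 < c) {U : State} (hU : U ∈ G) : c • U ∈ G := by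
  rw [mem_G_iff] at hU ⊢
  refine ⟨?_, fun v => ?_⟩
  · rw [density_smul]; exact mul_pos hc hU.1
  · rw [shiftedEnergy_smul]; exact mul_pos hc (hU.2 v)

theorem zero_mem_closedCone : (0 : State) ∈ closedCone := by
  simp [closedCone, density, shiftedEnergy, momentum, energy]

theorem add_mem_closedCone {U V : State} (hU : U ∈ closedCone) (hV : V ∈ closedCone) :
    U + V ∈ closedCone := by
  refine ⟨?_, fun v => ?_⟩
  · rw [density_add]; exact add_nonneg hU.1 hV.1
  · rw [shiftedEnergy_add]; exact add_nonneg (hU.2 v) (hV.2 v)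

theorem smul_mem_closedCone {c : ℝ} (hc : 0 ≤ c) {U : State} (hU : U ∈ closedCone) :
    c • U ∈ closedCone := by
  refine ⟨?_, fun v => ?_⟩
  · rw [density_smul]; exact mul_nonneg hc hU.1
  · rw [shiftedEnergy_smul]; exact mul_nonneg hc (hU.2 v)

theorem sum_mem_closedCone {ι : Type*} {s : Finset ι} {f : ι → State}
    (h : ∀ i ∈ s, f i ∈ closedCone) : ∑ i ∈ s, f i ∈ closedCone :=
  Finset.sum_induction f (· ∈ closedCone) (fun _ _ => add_mem_closedCone) zero_mem_closedCone h

theorem sum_mem_G {ι : Type*} {s : Finset ι} (hs : s.Nonempty) {f : ι → State}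
    (h : ∀ i ∈ s, f i ∈ G) : ∑ i ∈ s, f i ∈ G :=
  Finset.sum_induction_nonempty f (· ∈ G)
    (fun _ _ hU hV => add_mem_G hU (G_subset_closedCone hV)) hs h

/-! ### Source terms as accelerations. -/

/-- The acceleration `a` changes a state by `(0, ρ a, m · a)`. -/
def accelerate (U : State) (a : Plane) : State := (0, density U • a, ⟪momentum U, a⟫)

/-- With `w = u - v` the functional takes the value `ρ (α (e + ‖w‖²/2) + w·a)`. By the
arithmetic-geometric mean inequality `e + ‖w‖²/2 ≥ √(2e) ‖w‖`, and Cauchy–Schwarz bounds `w·a` below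
by `-‖w‖ ‖a‖`. -/
theorem smul_add_accelerate_mem_closedCone {U : State} (hU : U ∈ G) {α : ℝ} {a : Plane}
    (hα : ‖a‖ / √(2 * specificEnergy U) ≤ α) : α • U + accelerate U a ∈ closedCone := by
  obtain ⟨ρ, u, e, hρ, he, rfl⟩ := exists_primState hU
  rw [specificEnergy_primState hρ.ne', div_le_iff₀ (by positivity)] at hα
  set s := √(2 * e) with hs
  have hs0 : 0 < s := by positivity
  have hs2 : s ^ 2 = 2 * e := Real.sq_sqrt (by positivity)
  have hα0 : 0 ≤ α := by
    by_contra! h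
    nlinarith [norm_nonneg a]
  refine ⟨?_, fun v => ?_⟩
  · simp only [density_add, density_smul, density_primState, accelerate]
    simp only [density, add_zero]
    positivity
  · have h1 : shiftedEnergy v (accelerate (primState ρ u e) a) = ρ * ⟪u - v, a⟫ := by
      simp only [shiftedEnergy, accelerate, energy, momentum, density, primState,
        real_inner_smul_left, inner_sub_left, real_inner_comm a v]
      ring
    rw [shiftedEnergy_add, shiftedEnergy_smul, shiftedEnergy_primState, h1]
    have h2 : -(‖u - v‖ * ‖a‖) ≤ ⟪u - v, a⟫ :=
      (abs_le.1 (abs_real_inner_le_norm (u - v) a)).1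
    have h3 : ‖u - v‖ * ‖a‖ ≤ ‖u - v‖ * (α * s) := by gcongr
    have h4 : 0 ≤ α * (e + ‖u - v‖ ^ 2 / 2) + ⟪u - v, a⟫ := by
      nlinarith [mul_nonneg hα0 (sq_nonneg (s - ‖u - v‖))]
    nlinarith [mul_nonneg hρ.le h4]

/-! ### Wave estimates for the HLLC flux. -/

section wave

variable {γ : ℝ} {n : Plane}

theorem smul_sub_flux_mem_G (hγ : 1 < γ) (hn : ‖n‖ = 1)
    {U : State} (hU : U ∈ G) {α : ℝ} (hα : alpha γ n U ≤ α) :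
    α • U - flux γ U n ∈ G := by
  obtain ⟨ρ, u, e, hρ, he, rfl⟩ := exists_primState hU
  rw [alpha_primState hρ.ne'] at hα
  have hc : 0 < γ * (γ - 1) * e := by have := sub_pos.2 hγ; positivity
  set c := √(γ * (γ - 1) * e) with hcdef
  have hc0 : 0 < c := by positivity
  have hc2 : c ^ 2 = γ * (γ - 1) * e := Real.sq_sqrt hc.le
  have hq := le_abs_self ⟪u, n⟫
  obtain ⟨a, ha⟩ : ∃ a, a = α - ⟪u, n⟫ := ⟨_, rfl⟩
  have hac : c ≤ a := by linarith
  rw [mem_G_iff]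
  refine ⟨?_, fun v => ?_⟩
  · have : density (α • primState ρ u e - flux γ (primState ρ u e) n) = ρ * a := by
      rw [ha, flux, velocity_primState hρ.ne']
      simp only [primState, density, Prod.fst_sub, Prod.smul_fst, smul_eq_mul]
      ring
    rw [this]
    have : 0 < a := hc0.trans_le hac
    positivity
  · have h1 : shiftedEnergy v (α • primState ρ u e - flux γ (primState ρ u e) n)
        = ρ * (a * (e + ‖u - v‖ ^ 2 / 2) - (γ - 1) * e * ⟪u - v, n⟫) := by
      rw [ha, flux, velocity_primState hρ.ne', pressure_primState hρ.ne', norm_sub_sq_real]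
      simp only [shiftedEnergy, primState, density, energy, momentum, Prod.fst_sub, Prod.snd_sub,
        Prod.smul_fst, Prod.smul_snd, smul_eq_mul, inner_sub_left, inner_add_left,
        real_inner_smul_left, real_inner_comm v n]
      ring
    rw [h1]
    refine mul_pos hρ ?_
    have h2 : ⟪u - v, n⟫ ≤ ‖u - v‖ := by
      simpa [hn] using real_inner_le_norm (u - v) n
    have ha0 : 0 < a := hc0.trans_le hac
    have h3 : (γ - 1) * e * ⟪u - v, n⟫ ≤ (γ - 1) * e * ‖u - v‖ :=
      mul_le_mul_of_nonneg_left h2 (mul_nonneg (by linarith) he.le)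
    -- After multiplication by `a`, completing the square in `a‖u - v‖` leaves at least `a²e -
    -- ((γ-1)e)²/2`. Since `a² ≥ c² = γ(γ-1)e`, this is at least `(γ-1)(γ+1)e²/2 > 0`.
    suffices 0 < a * (a * (e + ‖u - v‖ ^ 2 / 2) - (γ - 1) * e * ‖u - v‖) by
      have := (mul_pos_iff_of_pos_left ha0).1 this
      linarith
    have h4 : γ * (γ - 1) * e ≤ a ^ 2 := by rw [← hc2]; gcongr
    have h5 : γ * (γ - 1) * e * e ≤ a ^ 2 * e := by gcongr
    have h6 : 0 < (γ - 1) * (γ + 1) * e ^ 2 := by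
      have := sub_pos.2 hγ; positivity
    nlinarith [sq_nonneg (a * ‖u - v‖ - (γ - 1) * e)]

theorem starState_primState (hn : ‖n‖ = 1) {ρ e S Sstar : ℝ} {u : Plane}
    (hρ : ρ ≠ 0) (hS : S ≠ ⟪u, n⟫) :
    starState γ (primState ρ u e) S Sstar n =
      primState (ρ * ((S - ⟪u, n⟫) / (S - Sstar))) (u + (Sstar - ⟪u, n⟫) • n)
        (e + (Sstar - ⟪u, n⟫) ^ 2 / 2 + (Sstar - ⟪u, n⟫) * ((γ - 1) * e / (S - ⟪u, n⟫))) := by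
  have hS' := sub_ne_zero.2 hS
  rw [starState, velocity_primState hρ, pressure_primState hρ]
  simp only [primState, density, energy, Prod.smul_mk, smul_eq_mul, mul_one, Prod.mk.injEq,
    true_and]
  rw [norm_add_sq_real, norm_smul, hn, real_inner_smul_right]
  simp only [Real.norm_eq_abs, mul_one, sq_abs]
  -- For `S = Sstar` division by zero makes the density factor vanish on both sides, so the identity
  -- still holds.
  rcases eq_or_ne (S - Sstar) 0 with h | h
  · simp [h]
  field_simp
  ring

/-- The specific internal energy of the star state is quadratic in `d = Sstar - q`. Its minimum over
`d` is `e - ((γ-1)e)²/(2(S-q)²)`, positive as soon as the signal speed is at least sonic relative to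
the flow. The value of `Sstar` matters only for the sign of the density. -/
theorem starState_mem_G (hγ : 1 < γ) (hn : ‖n‖ = 1) {ρ e S Sstar : ℝ} {u : Plane}
    (hρ : 0 < ρ) (he : 0 < e)
    (hS : γ * (γ - 1) * e ≤ (S - ⟪u, n⟫) ^ 2) (hSs : 0 < (S - ⟪u, n⟫) / (S - Sstar)) :
    starState γ (primState ρ u e) S Sstar n ∈ G := by
  have hγ' := sub_pos.2 hγ
  have hne : S - ⟪u, n⟫ ≠ 0 := fun h => by simp [h] at hSs
  rw [starState_primState hn hρ.ne' (sub_ne_zero.1 hne)]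
  refine primState_mem_G (by positivity) ?_
  set d := Sstar - ⟪u, n⟫
  set a := S - ⟪u, n⟫
  have h1 : 0 < a ^ 2 := by positivity
  have h2 : e + d ^ 2 / 2 + d * ((γ - 1) * e / a)
      = (a ^ 2 * e - ((γ - 1) * e) ^ 2 / 2 + (a * d + (γ - 1) * e) ^ 2 / 2) / a ^ 2 := by
    field_simp
    ring
  rw [h2]
  have h5 : γ * (γ - 1) * e * e ≤ a ^ 2 * e := by gcongr
  have h6 : 0 < (γ - 1) * (γ + 1) * e ^ 2 := by positivity
  apply div_pos _ h1
  nlinarith [sq_nonneg (a * d + (γ - 1) * e)]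

/-- This form exhibits the star pressure `p + ρ(S - q)(Sstar - q)`: apart from transport with speed
`Sstar`, the flux carries only pressure. Equal star pressures on the two sides then give the jump
condition across the contact wave. -/
theorem starFlux_primState (hn : ‖n‖ = 1) {ρ e S Sstar : ℝ} {u : Plane}
    (hρ : ρ ≠ 0) (hS : S ≠ ⟪u, n⟫)
    (hSs : S ≠ Sstar) :
    starFlux γ (primState ρ u e) S Sstar n =
      Sstar • starState γ (primState ρ u e) S Sstar n +
        ((0, ((γ - 1) * (ρ * e) + ρ * (S - ⟪u, n⟫) * (Sstar - ⟪u, n⟫)) • n,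
          ((γ - 1) * (ρ * e) + ρ * (S - ⟪u, n⟫) * (Sstar - ⟪u, n⟫)) * Sstar) : State) := by
  have hS' := sub_ne_zero.2 hS
  have hSs' := sub_ne_zero.2 hSs
  rw [starFlux, starState_primState hn hρ hS, flux, velocity_primState hρ, pressure_primState hρ]
  simp only [primState, density, energy]
  rw [norm_add_sq_real, norm_smul, hn, real_inner_smul_right]
  simp only [Real.norm_eq_abs, mul_one, sq_abs, Prod.smul_mk, Prod.mk_add_mk, Prod.mk_sub_mk,
    smul_eq_mul, Prod.mk.injEq]
  refine ⟨?_, ?_, ?_⟩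
  · field_simp
    ring
  · match_scalars
    · field_simp
      ring
    · field_simp
      ring
  · field_simp
    ring

/-- Clearing the negative denominator, the left bound becomes `pR - pL < rL(SL-qL)² +
rR(SR-qR)(qR-SL)`. Because `SL` and `SR` bound the sonic speeds of both states, the last product is
at least `rR cR² > pR`. The right bound is symmetric. -/
theorem starSpeed_bounds {pL pR rL rR qL qR cL cR SL SR : ℝ} (hrL : 0 < rL) (hrR : 0 < rR)
    (hcL : 0 < cL) (hcR : 0 < cR) (hpL : 0 < pL) (hpR : 0 < pR) (hpcL : pL < rL * cL ^ 2)
    (hpcR : pR < rR * cR ^ 2) (hLL : SL ≤ qL - cL) (hLR : SL ≤ qR - cR) (hRL : qL + cL ≤ SR)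
    (hRR : qR + cR ≤ SR) :
    rL * (SL - qL) - rR * (SR - qR) < 0 ∧
    SL < (pR - pL + rL * qL * (SL - qL) - rR * qR * (SR - qR)) /
      (rL * (SL - qL) - rR * (SR - qR)) ∧
    (pR - pL + rL * qL * (SL - qL) - rR * qR * (SR - qR)) /
      (rL * (SL - qL) - rR * (SR - qR)) < SR := by
  have hD : rL * (SL - qL) - rR * (SR - qR) < 0 := by
    have h1 := mul_pos hrL (show 0 < qL - SL by linarith)
    have h2 := mul_pos hrR (show 0 < SR - qR by linarith)
    linarith
  refine ⟨hD, ?_, ?_⟩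
  · rw [lt_div_iff_of_neg hD]
    have h1 : cR * cR ≤ (qR - SL) * (SR - qR) :=
      mul_le_mul (by linarith) (by linarith) hcR.le (by linarith)
    have h2 := mul_le_mul_of_nonneg_left h1 hrR.le
    have h3 := mul_nonneg hrL.le (sq_nonneg (SL - qL))
    linarith
  · rw [div_lt_iff_of_neg hD]
    have h1 : cL * cL ≤ (qL - SL) * (SR - qL) :=
      mul_le_mul (by linarith) (by linarith) hcL.le (by linarith)
    have h2 := mul_le_mul_of_nonneg_left h1 hrL.le
    have h3 := mul_nonneg hrR.le (sq_nonneg (SR - qR))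
    linarith

/-- The average over the left half of the fan of the approximate Riemann solver is admissible. -/
theorem smul_add_flux_sub_hllc_mem_G (hγ : 1 < γ) (hn : ‖n‖ = 1) {UL UR : State}
    (hL : UL ∈ G) (hR : UR ∈ G) {α : ℝ}
    (hαL : alpha γ n UL ≤ α) (hαR : alpha γ n UR ≤ α) :
    α • UL + (flux γ UL n - hllc γ UL UR n) ∈ G := by
  have hγ' := sub_pos.2 hγ
  obtain ⟨rL, uL, eL, hrL, heL, hUL⟩ := exists_primState hL
  obtain ⟨rR, uR, eR, hrR, heR, hUR⟩ := exists_primState hR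
  obtain ⟨cL, hcL⟩ : ∃ c, c = √(γ * (γ - 1) * eL) := ⟨_, rfl⟩
  obtain ⟨cR, hcR⟩ : ∃ c, c = √(γ * (γ - 1) * eR) := ⟨_, rfl⟩
  have hcL0 : 0 < cL := by rw [hcL]; positivity
  have hcR0 : 0 < cR := by rw [hcR]; positivity
  have hcL2 : cL ^ 2 = γ * (γ - 1) * eL := by rw [hcL]; exact Real.sq_sqrt (by positivity)
  have hcR2 : cR ^ 2 = γ * (γ - 1) * eR := by rw [hcR]; exact Real.sq_sqrt (by positivity)
  obtain ⟨qL, hqL⟩ : ∃ q, q = ⟪uL, n⟫ := ⟨_, rfl⟩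
  obtain ⟨qR, hqR⟩ : ∃ q, q = ⟪uR, n⟫ := ⟨_, rfl⟩
  obtain ⟨SL, hSL⟩ : ∃ S, S = speedL γ UL UR n := ⟨_, rfl⟩
  obtain ⟨SR, hSR⟩ : ∃ S, S = speedR γ UL UR n := ⟨_, rfl⟩
  obtain ⟨Ss, hSs⟩ : ∃ S, S = speedStar γ UL UR n := ⟨_, rfl⟩
  have hSL' : SL = min (qL - cL) (qR - cR) := by
    rw [hSL, speedL, hUL, hUR, velocity_primState hrL.ne', velocity_primState hrR.ne',
      soundSpeed_primState hrL.ne', soundSpeed_primState hrR.ne', hqL, hqR, hcL, hcR]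
  have hSR' : SR = max (qL + cL) (qR + cR) := by
    rw [hSR, speedR, hUL, hUR, velocity_primState hrL.ne', velocity_primState hrR.ne',
      soundSpeed_primState hrL.ne', soundSpeed_primState hrR.ne', hqL, hqR, hcL, hcR]
  have hSs' : Ss = ((γ - 1) * (rR * eR) - (γ - 1) * (rL * eL) + rL * qL * (SL - qL)
      - rR * qR * (SR - qR)) / (rL * (SL - qL) - rR * (SR - qR)) := by
    rw [hSs, speedStar, ← hSL, ← hSR, hUL, hUR, velocity_primState hrL.ne',
      velocity_primState hrR.ne', pressure_primState hrL.ne', pressure_primState hrR.ne', hqL, hqR]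
    rfl
  have hαL' : |qL| + cL ≤ α := by rwa [hUL, alpha_primState hrL.ne', ← hcL, ← hqL] at hαL
  have hαR' : |qR| + cR ≤ α := by rwa [hUR, alpha_primState hrR.ne', ← hcR, ← hqR] at hαR
  have hLL : SL ≤ qL - cL := hSL' ▸ min_le_left _ _
  have hLR : SL ≤ qR - cR := hSL' ▸ min_le_right _ _
  have hRL : qL + cL ≤ SR := hSR' ▸ le_max_left _ _
  have hRR : qR + cR ≤ SR := hSR' ▸ le_max_right _ _
  -- The leftmost wave does not leave `[-α, ∞)`, so `α + SL` is the length of the part of the fan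
  -- still occupied by `UL`.
  have hαSL : 0 ≤ α + SL := by
    have : -α ≤ SL := by
      rw [hSL']
      exact le_min (by linarith [neg_abs_le qL]) (by linarith [neg_abs_le qR])
    linarith
  have hα0 : 0 < α := by linarith [abs_nonneg qL]
  have hpL : (γ - 1) * (rL * eL) < rL * cL ^ 2 := by
    rw [hcL2]; linarith [mul_pos hγ' (mul_pos (mul_pos hγ' heL) hrL)]
  have hpR : (γ - 1) * (rR * eR) < rR * cR ^ 2 := by
    rw [hcR2]; linarith [mul_pos hγ' (mul_pos (mul_pos hγ' heR) hrR)]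
  obtain ⟨hD, hLs, hsR⟩ := starSpeed_bounds hrL hrR hcL0 hcR0 (by positivity) (by positivity)
    hpL hpR hLL hLR hRL hRR
  rw [← hSs'] at hLs hsR
  have hneL : SL ≠ qL := by linarith [hLL] |> fun h : SL < qL => h.ne
  have hneR : SR ≠ qR := by linarith [hRR] |> fun h : qR < SR => h.ne'
  obtain ⟨VL, hVL⟩ : ∃ V, V = starState γ UL SL Ss n := ⟨_, rfl⟩
  obtain ⟨VR, hVR⟩ : ∃ V, V = starState γ UR SR Ss n := ⟨_, rfl⟩
  have hVLG : VL ∈ G := by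
    rw [hVL, hUL]
    refine starState_mem_G hγ hn hrL heL ?_ ?_
    · rw [← hcL2, ← hqL, ← neg_sq (SL - qL)]
      exact pow_le_pow_left₀ hcL0.le (by linarith) 2
    · rw [← hqL]; exact div_pos_of_neg_of_neg (by linarith) (by linarith)
  have hVRG : VR ∈ G := by
    rw [hVR, hUR]
    refine starState_mem_G hγ hn hrR heR ?_ ?_
    · rw [← hcR2, ← hqR]
      exact pow_le_pow_left₀ hcR0.le (by linarith) 2
    · rw [← hqR]; exact div_pos (by linarith) (by linarith)
  -- The formula for `Ss` is precisely the equality of the two star pressures.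
  have hjump : starFlux γ UR SR Ss n = starFlux γ UL SL Ss n + Ss • (VR - VL) := by
    have hp : (γ - 1) * (rL * eL) + rL * (SL - qL) * (Ss - qL)
        = (γ - 1) * (rR * eR) + rR * (SR - qR) * (Ss - qR) := by
      have := (eq_div_iff hD.ne).1 hSs'
      linarith
    rw [hVL, hVR, hUL, hUR, starFlux_primState hn hrL.ne' (hqL ▸ hneL) hLs.ne,
      starFlux_primState hn hrR.ne' (hqR ▸ hneR) hsR.ne', ← hqL, ← hqR, hp, smul_sub]
    abel
  -- Summing the jump conditions over all three waves; this is consistency of the approximate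
  -- Riemann solver.
  have hFR : flux γ UR n = flux γ UL n + SL • (VL - UL) + Ss • (VR - VL) - SR • (VR - UR) := by
    have h : flux γ UR n + SR • (VR - UR) = flux γ UL n + SL • (VL - UL) + Ss • (VR - VL) := by
      rw [hVL, hVR] at *
      exact hjump
    rw [← h]; abel
  rw [hllc, ← hSL, ← hSR, ← hSs]
  -- In each case the coefficients are the lengths of the subintervals of `[-α, 0]` on which the fan
  -- equals `UL`, `VL`, `VR`, `UR`.
  split_ifs with h1 h2 h3
  · simpa using smul_mem_G hα0 hL
  · rw [starFlux, ← hVL]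
    have : α • UL + (flux γ UL n - (flux γ UL n + SL • (VL - UL)))
        = (-SL) • VL + (α + SL) • UL := by module
    rw [this]
    exact add_mem_G (smul_mem_G (by linarith) hVLG)
      (smul_mem_closedCone hαSL (G_subset_closedCone hL))
  · rw [hjump, starFlux, ← hVL]
    have : α • UL + (flux γ UL n - (flux γ UL n + SL • (VL - UL) + Ss • (VR - VL)))
        = (Ss - SL) • VL + ((-Ss) • VR + (α + SL) • UL) := by module
    rw [this]
    exact add_mem_G (smul_mem_G (by linarith) hVLG) (add_mem_closedCone
      (smul_mem_closedCone (by linarith) (G_subset_closedCone hVRG))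
      (smul_mem_closedCone hαSL (G_subset_closedCone hL)))
  · rw [hFR]
    have : α • UL + (flux γ UL n
          - (flux γ UL n + SL • (VL - UL) + Ss • (VR - VL) - SR • (VR - UR)))
        = (Ss - SL) • VL + ((SR - Ss) • VR + ((-SR) • UR + (α + SL) • UL)) := by module
    rw [this]
    exact add_mem_G (smul_mem_G (by linarith) hVLG) (add_mem_closedCone
      (smul_mem_closedCone (by linarith) (G_subset_closedCone hVRG)) (add_mem_closedCone
      (smul_mem_closedCone (by linarith) (G_subset_closedCone hR))
      (smul_mem_closedCone hαSL (G_subset_closedCone hL))))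

/-- One `α` pays for the physical flux `-F(UL)·n`, the other for the difference `F(UL)·n - F^hllc`;
hence the factor 2 in the CFL condition. -/
theorem smul_sub_hllc_mem_G (hγ : 1 < γ) (hn : ‖n‖ = 1) {UL UR : State}
    (hL : UL ∈ G) (hR : UR ∈ G) {α : ℝ}
    (hαL : alpha γ n UL ≤ α) (hαR : alpha γ n UR ≤ α) :
    (2 * α) • UL - hllc γ UL UR n ∈ G := by
  have : (2 * α) • UL - hllc γ UL UR n
      = (α • UL - flux γ UL n) + (α • UL + (flux γ UL n - hllc γ UL UR n)) := by module
  rw [this]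
  exact add_mem_G (smul_sub_flux_mem_G hγ hn hL hαL)
    (G_subset_closedCone (smul_add_flux_sub_hllc_mem_G hγ hn hL hR hαL hαR))

end wave

/-- Scaling changes `ρ` but neither `u` nor `e`. Hence the well-balanced rescaling by `p⋆/p` leaves
the wave speeds alone. -/
theorem alpha_smul {γ : ℝ} {n : Plane} {U : State} (hU : U ∈ G) {c : ℝ} (hc : 0 < c) :
    alpha γ n (c • U) = alpha γ n U := by
  obtain ⟨ρ, u, e, hρ, he, rfl⟩ := exists_primState hU
  rw [smul_primState, alpha_primState hρ.ne', alpha_primState (mul_pos hc hρ).ne']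

theorem alpha_pos {γ : ℝ} (hγ : 1 < γ) {n : Plane} {U : State} (hU : U ∈ G) :
    0 < alpha γ n U := by
  have := sub_pos.2 hγ
  obtain ⟨ρ, u, e, hρ, he, rfl⟩ := exists_primState hU
  rw [alpha_primState hρ.ne']
  positivity

end Euler

/-! ## The divergence theorem on polygonal cells -/

/-- The fundamental theorem of calculus on a compact set `S` of reals with finitely many boundary
points `t i`, at which `S` is locally a closed half-line with outward direction `c i`. -/
theorem setIntegral_deriv_eq_sum_boundary {ι : Type*} {X : Finset ι} {t c : ι → ℝ} {S : Set ℝ}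
    (hS : IsCompact S) (hinj : Set.InjOn t X) (hc : ∀ i ∈ X, c i ≠ 0)
    (hloc : ∀ i ∈ X, ∀ᶠ x in 𝓝 (t i), (x ∈ S ↔ (x - t i) * c i ≤ 0))
    (hoff : ∀ x, (∀ i ∈ X, x ≠ t i) → S ∈ 𝓝 x ∨ Sᶜ ∈ 𝓝 x) {f f' : ℝ → ℝ}
    (hf : ∀ x, HasDerivAt f (f' x) x) (hf' : Continuous f') :
    ∫ x in S, f' x = ∑ i ∈ X, Real.sign (c i) * f (t i) := by
  have hfc : Continuous f := continuous_iff_continuousAt.2 fun x => (hf x).continuousAt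
  -- `J i` is the step function that cancels the jump of `S.indicator f` at `t i`. Since `t i ∈ S`,
  -- the drop at a right end occurs after `t i` (strict inequality), and the rise at a left end
  -- occurs at `t i` itself.
  obtain ⟨J, hJ⟩ : ∃ J : ι → ℝ → ℝ, J = fun i x =>
    if 0 < c i then (if t i < x then f (t i) else 0) else (if t i ≤ x then -f (t i) else 0) :=
    ⟨_, rfl⟩
  have hJloc : ∀ i x, x ≠ t i → J i =ᶠ[𝓝 x] fun _ => J i x := by
    intro i x hx
    rcases lt_or_gt_of_ne hx with h | h
    · filter_upwards [gt_mem_nhds h] with y hy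
      simp [hJ, hy.not_gt, hy.not_ge, h.not_gt, h.not_ge]
    · filter_upwards [lt_mem_nhds h] with y hy
      simp [hJ, hy, hy.le, h, h.le]
  set g : ℝ → ℝ := fun x => S.indicator f x + ∑ i ∈ X, J i x with hg
  have hderiv : ∀ x, (∀ i ∈ X, x ≠ t i) → HasDerivAt g (S.indicator f' x) x := by
    intro x hx
    have h1 : HasDerivAt (fun y => ∑ i ∈ X, J i y) 0 x := by
      have := HasDerivAt.fun_sum (u := X) (A := J) (A' := fun _ => 0) (x := x) fun i hi =>
        (hasDerivAt_const x (J i x)).congr_of_eventuallyEq (hJloc i x (hx i hi))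
      simpa using this
    have h2 : HasDerivAt (S.indicator f) (S.indicator f' x) x := by
      rcases hoff x hx with h | h
      · rw [Set.indicator_of_mem (mem_of_mem_nhds h)]
        refine (hf x).congr_of_eventuallyEq ?_
        filter_upwards [h] with y hy using Set.indicator_of_mem hy f
      · rw [Set.indicator_of_notMem (mem_of_mem_nhds h : x ∈ Sᶜ)]
        refine (hasDerivAt_const x (0 : ℝ)).congr_of_eventuallyEq ?_
        filter_upwards [h] with y hy using Set.indicator_of_notMem hy f
    have := h2.add h1
    rw [add_zero] at this
    exact this
  have hcont : ∀ x, ContinuousAt g x := by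
    intro x
    by_cases hx : ∀ i ∈ X, x ≠ t i
    · exact (hderiv x hx).continuousAt
    push Not at hx
    obtain ⟨i, hi, rfl⟩ := hx
    classical
    have h1 : g = fun x => (S.indicator f x + J i x) + ∑ l ∈ X.erase i, J l x := by
      funext x
      simp only [hg]
      rw [← Finset.add_sum_erase X _ hi, add_assoc]
    rw [h1]
    refine ContinuousAt.add ?_ (tendsto_finsetSum _ fun l hl => ?_)
    -- Near `t i` the corrected function is `f` frozen on one side: `f (max x (t i)) - f (t i)` at a
    -- left end, `f (min x (t i))` at a right end.
    · rcases lt_or_gt_of_ne (hc i hi) with h | h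
      · have : ContinuousAt (fun x => f (max x (t i)) - f (t i)) (t i) := by fun_prop
        refine this.congr ?_
        filter_upwards [hloc i hi] with x hx
        by_cases hxt : t i ≤ x
        · have : x ∈ S := hx.2 (mul_nonpos_of_nonneg_of_nonpos (sub_nonneg.2 hxt) h.le)
          simp [hJ, this, h.not_gt, hxt, sub_eq_add_neg]
        · have : x ∉ S := fun hxS => by
            have := hx.1 hxS
            push Not at hxt
            nlinarith
          simp [hJ, this, h.not_gt, hxt, (not_le.1 hxt).le]
      · have : ContinuousAt (fun x => f (min x (t i))) (t i) := by fun_prop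
        refine this.congr ?_
        filter_upwards [hloc i hi] with x hx
        by_cases hxt : t i < x
        · have : x ∉ S := fun hxS => by
            have := hx.1 hxS
            nlinarith
          simp [hJ, this, h, hxt, hxt.le]
        · have : x ∈ S := hx.2 (mul_nonpos_of_nonpos_of_nonneg (by linarith) h.le)
          simp [hJ, this, h, hxt, not_lt.1 hxt]
    · have hne : t i ≠ t l := fun h =>
        (Finset.mem_erase.1 hl).1 (hinj hi (Finset.mem_of_mem_erase hl) h).symm
      exact (hJloc l (t i) hne).continuousAt
  obtain ⟨R, hR⟩ := (hS.isBounded.union (X.finite_toSet.image t).isBounded).subset_closedBall 0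
  have hSR : ∀ x ∈ S, |x| ≤ R := fun x hx => by simpa using hR (Or.inl hx)
  have htR : ∀ i ∈ X, |t i| ≤ R := fun i hi => by simpa using hR (Or.inr ⟨i, hi, rfl⟩)
  set b := |R| + 1
  have hRb : R < b := by have := le_abs_self R; simp only [b]; linarith
  have hb : 0 < b := by positivity
  have hint : IntervalIntegrable (S.indicator f') volume (-b) b := by
    apply Integrable.intervalIntegrable
    rw [integrable_indicator_iff hS.measurableSet]
    exact hf'.continuousOn.integrableOn_compact hS
  have key := integral_eq_of_hasDerivAt_off_countable g (S.indicator f') (a := -b) (b := b)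
    (X.finite_toSet.image t).countable (fun x _ => (hcont x).continuousWithinAt)
    (fun x hx => hderiv x fun i hi h => hx.2 ⟨i, hi, h.symm⟩) hint
  have hleft : ∫ x in (-b)..b, S.indicator f' x = ∫ x in S, f' x := by
    rw [intervalIntegral.integral_of_le (by linarith), setIntegral_indicator hS.measurableSet,
      Set.inter_eq_right.2]
    intro x hx
    have := abs_le.1 (hSR x hx)
    exact ⟨by linarith, by linarith⟩
  have hgb : g b = ∑ i ∈ X, Real.sign (c i) * f (t i) := by
    have : b ∉ S := fun h => by have := abs_le.1 (hSR b h); linarith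
    simp only [hg, Set.indicator_of_notMem this, zero_add]
    refine Finset.sum_congr rfl fun i hi => ?_
    have hi' : t i < b := by have := abs_le.1 (htR i hi); linarith
    rcases lt_or_gt_of_ne (hc i hi) with h | h
    · simp [hJ, h.not_gt, hi'.le, Real.sign_of_neg h]
    · simp [hJ, h, hi', Real.sign_of_pos h]
  have hga : g (-b) = 0 := by
    have : -b ∉ S := fun h => by have := abs_le.1 (hSR _ h); linarith
    simp only [hg, Set.indicator_of_notMem this, zero_add]
    refine Finset.sum_eq_zero fun i hi => ?_
    have hi' : -b < t i := by have := abs_le.1 (htR i hi); linarith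
    simp [hJ, hi'.not_gt, hi'.not_ge]
  rw [← hleft, key, hgb, hga, sub_zero]

theorem continuous_evalAt (p : MvPolynomial (Fin 2) ℝ) : Continuous (evalAt p) :=
  (MvPolynomial.continuous_eval p).comp (by fun_prop)

/-- The point whose coordinate `i` is `x` and whose other coordinate is `y`. -/
def slicePoint (i : Fin 2) (z : ℝ × ℝ) : Plane := WithLp.toLp 2 fun l => if l = i then z.2 else z.1

theorem slicePoint_apply (i : Fin 2) (z : ℝ × ℝ) (l : Fin 2) :
    slicePoint i z l = if l = i then z.2 else z.1 := rfl

theorem continuous_slicePoint (i : Fin 2) : Continuous (slicePoint i) := by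
  unfold slicePoint
  refine (PiLp.continuous_toLp 2 _).comp (continuous_pi fun l => ?_)
  split_ifs <;> fun_prop

theorem measurePreserving_slicePoint (i : Fin 2) : MeasurePreserving (slicePoint i) := by
  have h := (PiLp.volume_preserving_toLp (Fin 2)).comp (volume_preserving_finTwoArrow ℝ).symm
  fin_cases i
  · have h0 : slicePoint 0 = (WithLp.toLp 2 ∘ MeasurableEquiv.finTwoArrow.symm) ∘ Prod.swap := by
      funext z
      ext l
      fin_cases l <;> simp [slicePoint, MeasurableEquiv.finTwoArrow]
    exact h0 ▸ h.comp (Measure.measurePreserving_swap (μ := (volume : Measure ℝ)) (ν := volume))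
  · have h1 : slicePoint 1 = WithLp.toLp 2 ∘ MeasurableEquiv.finTwoArrow.symm := by
      funext z
      ext l
      fin_cases l <;> simp [slicePoint, MeasurableEquiv.finTwoArrow]
    exact h1 ▸ h

theorem measurableEmbedding_slicePoint (i : Fin 2) : MeasurableEmbedding (slicePoint i) := by
  refine (continuous_slicePoint i).measurableEmbedding fun z w h => ?_
  have h0 := congrArg (fun x : Plane => x 0) h
  have h1 := congrArg (fun x : Plane => x 1) h
  fin_cases i <;> simp [slicePoint_apply] at h0 h1 <;> ext <;> assumption

theorem hasDerivAt_evalAt_slicePoint (p : MvPolynomial (Fin 2) ℝ) (i : Fin 2) (y x : ℝ) :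
    HasDerivAt (fun x => evalAt p (slicePoint i (y, x)))
      (evalAt (MvPolynomial.pderiv i p) (slicePoint i (y, x))) x := by
  induction p using MvPolynomial.induction_on with
  | C a => simpa [evalAt] using hasDerivAt_const x a
  | add p q hp hq => 
    simp only [evalAt, map_add] at hp hq ⊢
    exact hp.add hq
  | mul_X p l hp =>
    have hl : HasDerivAt (fun x => slicePoint i (y, x) l) (if l = i then 1 else 0) x := by
      simp only [slicePoint_apply]
      split_ifs
      · exact hasDerivAt_id x
      · exact hasDerivAt_const x y
    have := hp.mul hl
    simp only [evalAt, map_mul, MvPolynomial.eval_X, MvPolynomial.pderiv_mul, map_add,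
      MvPolynomial.pderiv_X] at this ⊢
    refine HasDerivAt.congr_deriv (f := fun x => _) this ?_
    congr 2
    by_cases h : l = i
    · simp [h]
    · simp [h, Pi.single_eq_of_ne]

theorem integral_slice (i : Fin 2) {K : Set Plane} (hK : IsCompact K) {g : Plane → ℝ}
    (hg : Continuous g) :
    ∫ x in K, g x = ∫ y : ℝ, ∫ x in {x | slicePoint i (y, x) ∈ K}, g (slicePoint i (y, x)) := by
  have hm : MeasurableSet (slicePoint i ⁻¹' K) :=
    (continuous_slicePoint i).measurable hK.measurableSet
  have h1 : IntegrableOn (fun z => g (slicePoint i z)) (slicePoint i ⁻¹' K) :=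
    ((measurePreserving_slicePoint i).integrableOn_comp_preimage
      (measurableEmbedding_slicePoint i)).2 (hg.continuousOn.integrableOn_compact hK)
  rw [← (measurePreserving_slicePoint i).setIntegral_preimage_emb
    (measurableEmbedding_slicePoint i), ← integral_indicator hm]
  rw [← integrable_indicator_iff hm] at h1
  refine (integral_prod _ h1).trans (integral_congr_ae (Filter.Eventually.of_forall fun y => ?_))
  have hm' : MeasurableSet {x | slicePoint i (y, x) ∈ K} := by
    have : Measurable fun x => slicePoint i (y, x) :=
      ((continuous_slicePoint i).comp (by fun_prop)).measurable
    exact this hK.measurableSet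
  simp only
  rw [← integral_indicator hm']
  rfl

section edge

theorem add_smul_sub_mem_openSegment {a b : Plane} {s : ℝ} (h0 : 0 < s) (h1 : s < 1) :
    a + s • (b - a) ∈ openSegment ℝ a b := by
  rw [openSegment_eq_image']
  exact ⟨s, ⟨h0, h1⟩, rfl⟩

variable {K : Set Plane} {a b n : Plane}

/-- Orthogonality is not part of the definition. Moving along the edge in either direction from its
midpoint stays in `K`, so the half-plane inequality holds with both signs. -/
theorem IsOutwardNormal.inner_sub_eq_zero (h : IsOutwardNormal K a b n)
    (hK : openSegment ℝ a b ⊆ K) : ⟪b - a, n⟫ = 0 := by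
  have hline : ∀ s : ℝ, a + s • (b - a) - (a + (1 / 2 : ℝ) • (b - a)) = (s - 1 / 2) • (b - a) :=
    fun s => by module
  have h1 := h.2 _ (add_smul_sub_mem_openSegment (a := a) (b := b) (s := 1 / 2) (by norm_num)
    (by norm_num))
  have hc : ContinuousAt (fun s : ℝ => a + s • (b - a)) (1 / 2) := by fun_prop
  have h2 := hc.eventually h1
  have h3 : ∀ᶠ s in 𝓝 (1 / 2 : ℝ), s ∈ Set.Ioo (0 : ℝ) 1 :=
    Ioo_mem_nhds (by norm_num) (by norm_num)
  have h4 : ∀ᶠ s in 𝓝 (1 / 2 : ℝ), (s - 1 / 2) * ⟪b - a, n⟫ ≤ 0 := by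
    filter_upwards [h2, h3] with s hs hs'
    have := hs.1 (hK (add_smul_sub_mem_openSegment hs'.1 hs'.2))
    rwa [hline, real_inner_smul_left] at this
  obtain ⟨ε, hε, hball⟩ := Metric.eventually_nhds_iff.1 h4
  have hp := hball (y := 1 / 2 + ε / 2) (by simp [abs_of_pos hε, hε])
  have hm := hball (y := 1 / 2 - ε / 2) (by simp [abs_of_pos hε, hε])
  apply le_antisymm <;> nlinarith

/-- In the plane `n` is a quarter turn of the unit tangent, up to sign. This is the Jacobian between
arc length and the coordinate `j` along the edge. -/
theorem dist_mul_abs_normal (hn : ‖n‖ = 1) (h : ⟪b - a, n⟫ = 0) {i j : Fin 2} (hij : i ≠ j) :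
    dist a b * |n i| = |b j - a j| := by
  have hn2 : n i ^ 2 + n j ^ 2 = 1 := by
    have := EuclideanSpace.real_norm_sq_eq n
    rw [hn, Fin.sum_univ_two] at this
    fin_cases i <;> fin_cases j <;> simp at hij ⊢ <;> linarith
  have hd : dist a b ^ 2 = (b i - a i) ^ 2 + (b j - a j) ^ 2 := by
    rw [dist_comm, dist_eq_norm, EuclideanSpace.real_norm_sq_eq, Fin.sum_univ_two]
    fin_cases i <;> fin_cases j <;> simp at hij ⊢
    ring
  have hi : (b i - a i) * n i + (b j - a j) * n j = 0 := by
    rw [PiLp.inner_apply, Fin.sum_univ_two] at h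
    simp only [PiLp.sub_apply, RCLike.inner_apply, conj_trivial] at h
    fin_cases i <;> fin_cases j <;> simp at hij ⊢ <;> linarith
  rw [← abs_of_nonneg (dist_nonneg (x := a) (y := b)), ← abs_mul, ← sq_eq_sq_iff_abs_eq_abs,
    mul_pow, hd]
  have : (b i - a i) ^ 2 * n i ^ 2 = (b j - a j) ^ 2 * n j ^ 2 := by
    rw [← mul_pow, ← mul_pow, eq_neg_of_add_eq_zero_left hi, neg_sq]
  linear_combination this + (b j - a j) ^ 2 * hn2

end edge

theorem setIntegral_uIoc_comp_sub_div {a b : ℝ} (g : ℝ → ℝ) :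
    ∫ y in Set.uIoc a b, g ((y - a) / (b - a)) = |b - a| * ∫ s in (0 : ℝ)..1, g s := by
  rcases eq_or_ne a b with rfl | hab
  · simp
  have hd : b - a ≠ 0 := sub_ne_zero.2 hab.symm
  have h1 : ∫ y in a..b, g ((y - a) / (b - a)) = (b - a) * ∫ s in (0 : ℝ)..1, g s := by
    simp only [sub_div]
    rw [intervalIntegral.integral_comp_div_sub (fun s => g s) hd]
    rw [sub_self, ← sub_div, div_self hd, smul_eq_mul]
  rw [intervalIntegral.intervalIntegral_eq_integral_uIoc] at h1
  rcases lt_or_gt_of_ne hab with h | h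
  · rw [abs_of_pos (by linarith), ← h1, if_pos h.le, one_smul]
  · rw [abs_of_neg (by linarith), neg_mul, ← h1, if_neg h.not_ge, neg_smul, one_smul, neg_neg]

namespace PolygonalMesh

variable {Ω : Set Plane} {C E : Type*} (T : PolygonalMesh Ω C E)

theorem segment_subset_cell {K : C} {e : E} (he : e ∈ T.edges K) :
    segment ℝ (T.src e) (T.tgt e) ⊆ T.cell K := by
  refine Set.Subset.trans ?_ (T.isCompact_cell K).isClosed.frontier_subset
  rw [T.frontier_cell]
  exact Set.subset_biUnion_of_mem (u := fun e => segment ℝ (T.src e) (T.tgt e)) he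

theorem inner_normal_eq_zero {K : C} {e : E} (he : e ∈ T.edges K) :
    ⟪T.tgt e - T.src e, T.normal K e⟫ = 0 :=
  (T.isOutwardNormal K e he).inner_sub_eq_zero
    ((openSegment_subset_segment _ _ _).trans (T.segment_subset_cell he))

theorem edgeLength_mul_abs_normal {K : C} {e : E} (he : e ∈ T.edges K) {i j : Fin 2}
    (hij : i ≠ j) : T.edgeLength e * |T.normal K e i| = |T.tgt e j - T.src e j| :=
  dist_mul_abs_normal (T.isOutwardNormal K e he).1 (T.inner_normal_eq_zero he) hij

/-- The point of the line through the edge `e` whose coordinate `j` is `y`. -/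
def crossing (e : E) (j : Fin 2) (y : ℝ) : Plane :=
  T.src e + ((y - T.src e j) / (T.tgt e j - T.src e j)) • (T.tgt e - T.src e)

theorem slicePoint_crossing {e : E} {i j : Fin 2} (hij : i ≠ j) {y : ℝ}
    (h : T.src e j ≠ T.tgt e j) : slicePoint i (y, T.crossing e j y i) = T.crossing e j y := by
  have hd : T.tgt e j - T.src e j ≠ 0 := sub_ne_zero.2 h.symm
  ext l
  rw [slicePoint_apply]
  split_ifs with hl
  · rw [hl]
  · have hlj : l = j := by omega
    simp only [crossing, hlj, PiLp.add_apply, PiLp.smul_apply, PiLp.sub_apply, smul_eq_mul]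
    rw [div_mul_cancel₀ _ hd]
    ring

theorem crossing_mem_openSegment {e : E} {j : Fin 2} {y : ℝ}
    (hy : y ∈ Set.uIoc (T.src e j) (T.tgt e j)) (hy1 : y ≠ T.src e j) (hy2 : y ≠ T.tgt e j) :
    T.crossing e j y ∈ openSegment ℝ (T.src e) (T.tgt e) := by
  rw [Set.mem_uIoc] at hy
  rcases hy with ⟨h1, h2⟩ | ⟨h1, h2⟩
  · have h3 := lt_of_le_of_ne h2 hy2
    refine add_smul_sub_mem_openSegment (div_pos (by linarith) (by linarith)) ?_
    rw [div_lt_one (by linarith)]; linarith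
  · have h3 := lt_of_le_of_ne h2 hy1
    refine add_smul_sub_mem_openSegment (div_pos_of_neg_of_neg (by linarith) (by linarith)) ?_
    rw [div_lt_one_of_neg (by linarith)]; linarith

theorem eq_crossing {e : E} {i j : Fin 2} (hij : i ≠ j) {x y : ℝ}
    (h : slicePoint i (y, x) ∈ segment ℝ (T.src e) (T.tgt e)) (hy1 : y ≠ T.src e j)
    (hy2 : y ≠ T.tgt e j) :
    y ∈ Set.uIoc (T.src e j) (T.tgt e j) ∧ x = T.crossing e j y i := by
  rw [segment_eq_image'] at h
  obtain ⟨s, ⟨hs0, hs1⟩, hs⟩ := h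
  have hj := congrArg (fun z : Plane => z j) hs
  have hi := congrArg (fun z : Plane => z i) hs
  simp only [PiLp.add_apply, PiLp.smul_apply, PiLp.sub_apply, smul_eq_mul, slicePoint_apply,
    hij.symm, if_true, if_false] at hi hj
  have hd : T.tgt e j - T.src e j ≠ 0 := fun h => hy1 (by rw [← hj, h]; ring)
  have hs' : s = (y - T.src e j) / (T.tgt e j - T.src e j) := by
    rw [eq_div_iff hd]; linarith
  constructor
  · rw [Set.mem_uIoc]
    rcases lt_or_gt_of_ne hd with h | h
    · right
      have : y ≠ T.src e j := hy1
      constructor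
      · refine lt_of_le_of_ne ?_ hy2.symm
        nlinarith
      · nlinarith
    · left
      constructor
      · refine lt_of_le_of_ne ?_ hy1.symm
        nlinarith
      · nlinarith
  · rw [← hi, hs']
    simp [crossing]

/-- A line through no vertex meets the boundary of the cell only by crossing edges transversally, so
the one-dimensional fundamental theorem applies to the slice. The sign of `n_i` tells whether the
line leaves or enters the cell. -/
theorem integral_slice_pderiv (K : C) (p : MvPolynomial (Fin 2) ℝ) {i j : Fin 2} (hij : i ≠ j)
    {y : ℝ} (hy : ∀ e ∈ T.edges K, y ≠ T.src e j ∧ y ≠ T.tgt e j) :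
    ∫ x in {x | slicePoint i (y, x) ∈ T.cell K},
        evalAt (MvPolynomial.pderiv i p) (slicePoint i (y, x)) =
      ∑ e ∈ T.edges K, (Set.uIoc (T.src e j) (T.tgt e j)).indicator
        (fun y => Real.sign (T.normal K e i) * evalAt p (T.crossing e j y)) y := by
  classical
  have hcont : Continuous fun x : ℝ => slicePoint i (y, x) :=
    (continuous_slicePoint i).comp (by fun_prop)
  set X := (T.edges K).filter fun e => y ∈ Set.uIoc (T.src e j) (T.tgt e j) with hX
  have hXe : ∀ e ∈ X, T.src e j ≠ T.tgt e j := by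
    intro e he h
    have := (Finset.mem_filter.1 he).2
    simp [h] at this
  have hXo : ∀ e ∈ X, T.crossing e j y ∈ openSegment ℝ (T.src e) (T.tgt e) := by
    intro e he
    obtain ⟨h1, h2⟩ := Finset.mem_filter.1 he
    exact T.crossing_mem_openSegment h2 (hy e h1).1 (hy e h1).2
  have hcompact : IsCompact {x | slicePoint i (y, x) ∈ T.cell K} := by
    have hcl : IsClosed {x | slicePoint i (y, x) ∈ T.cell K} :=
      (T.isCompact_cell K).isClosed.preimage hcont
    have himg : IsCompact ((fun z : Plane => z i) '' T.cell K) :=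
      (T.isCompact_cell K).image (by fun_prop)
    refine himg.of_isClosed_subset hcl fun x hx => ⟨_, hx, ?_⟩
    simp [slicePoint_apply]
  have key := setIntegral_deriv_eq_sum_boundary (X := X) (t := fun e => T.crossing e j y i)
    (c := fun e => T.normal K e i) hcompact ?_ ?_ ?_ ?_
    (hasDerivAt_evalAt_slicePoint p i y) ((continuous_evalAt _).comp hcont)
  · rw [key, hX, Finset.sum_filter]
    refine Finset.sum_congr rfl fun e he => ?_
    rw [Set.indicator_apply]
    split_ifs with h
    · rw [T.slicePoint_crossing hij (hXe e (Finset.mem_filter.2 ⟨he, h⟩))]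
    · rfl
  -- Equal crossing abscissas would give a common point of two distinct edges, interior to one of
  -- them.
  · intro e he e' he' h
    by_contra hne
    have h1 := T.slicePoint_crossing hij (y := y) (hXe e he)
    have h2 := T.slicePoint_crossing hij (y := y) (hXe e' he')
    have h' : T.crossing e j y i = T.crossing e' j y i := h
    rw [h', h2] at h1
    exact Set.disjoint_left.1 (T.disjoint_edges e e' hne) (hXo e he)
      (h1 ▸ openSegment_subset_segment _ _ _ (hXo e' he'))
  · intro e he h
    have := T.edgeLength_mul_abs_normal (Finset.mem_filter.1 he).1 hij
    simp only at h
    rw [h, abs_zero, mul_zero] at this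
    exact hXe e he (sub_eq_zero.1 (abs_eq_zero.1 this.symm)).symm
  · intro e he
    have h1 := T.slicePoint_crossing hij (y := y) (hXe e he)
    have h2 := (T.isOutwardNormal K e (Finset.mem_filter.1 he).1).2 _ (hXo e he)
    rw [← h1] at h2
    filter_upwards [hcont.continuousAt.eventually h2] with x hx
    refine hx.trans ?_
    have : slicePoint i (y, x) - slicePoint i (y, T.crossing e j y i)
        = EuclideanSpace.single i (x - T.crossing e j y i) := by
      ext l
      simp only [PiLp.sub_apply, slicePoint_apply, PiLp.single_apply]
      split_ifs <;> simp
    rw [this, EuclideanSpace.inner_single_left, conj_trivial]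
  · intro x hx
    have hnot : slicePoint i (y, x) ∉ frontier (T.cell K) := by
      rw [T.frontier_cell]
      intro h
      obtain ⟨e, he, h⟩ := Set.mem_iUnion₂.1 h
      obtain ⟨h1, h2⟩ := T.eq_crossing hij h (hy e he).1 (hy e he).2
      exact hx e (Finset.mem_filter.2 ⟨he, h1⟩) h2
    by_cases hmem : slicePoint i (y, x) ∈ T.cell K
    · left
      have : slicePoint i (y, x) ∈ interior (T.cell K) := by
        by_contra h
        exact hnot ⟨subset_closure hmem, h⟩
      exact hcont.continuousAt.preimage_mem_nhds (mem_interior_iff_mem_nhds.1 this)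
    · right
      exact hcont.continuousAt.preimage_mem_nhds
        ((T.isCompact_cell K).isClosed.isOpen_compl.mem_nhds hmem)

/-- The divergence theorem on a polygonal cell, for a polynomial vector field parallel to a
coordinate axis. -/
theorem setIntegral_pderiv (K : C) (p : MvPolynomial (Fin 2) ℝ) (i : Fin 2) :
    ∫ x in T.cell K, evalAt (MvPolynomial.pderiv i p) x =
      ∑ e ∈ T.edges K, T.edgeLength e * T.normal K e i *
        ∫ s in (0 : ℝ)..1, evalAt p (T.src e + s • (T.tgt e - T.src e)) := by
  obtain ⟨j, hij⟩ : ∃ j, i ≠ j := ⟨1 - i, by fin_cases i <;> decide⟩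
  rw [integral_slice i (T.isCompact_cell K) (continuous_evalAt _)]
  -- Lines through vertices form a null set; lines containing an edge parallel to the slices are
  -- among them.
  have hae : ∀ᵐ y : ℝ, ∀ e ∈ T.edges K, y ≠ T.src e j ∧ y ≠ T.tgt e j := by
    rw [Finset.eventually_all]
    intro e _
    exact (Measure.ae_ne volume _).and (Measure.ae_ne volume _)
  rw [integral_congr_ae (hae.mono fun y hy => T.integral_slice_pderiv K p hij hy),
    integral_finsetSum]
  · refine Finset.sum_congr rfl fun e he => ?_
    rw [integral_indicator measurableSet_uIoc, integral_const_mul]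
    have h := setIntegral_uIoc_comp_sub_div (a := T.src e j) (b := T.tgt e j)
      fun s => evalAt p (T.src e + s • (T.tgt e - T.src e))
    simp only [crossing]
    rw [h, ← T.edgeLength_mul_abs_normal he hij, ← mul_assoc]
    congr 1
    rw [mul_left_comm]
    congr 1
    rcases lt_trichotomy (T.normal K e i) 0 with h | h | h
    · simp [Real.sign_of_neg h, abs_of_neg h]
    · simp [h]
    · simp [Real.sign_of_pos h, abs_of_pos h]
  · intro e _
    rw [integrable_indicator_iff measurableSet_uIoc]
    refine Continuous.integrableOn_uIoc ?_
    refine continuous_const.mul ((continuous_evalAt p).comp ?_)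
    unfold crossing
    fun_prop

end PolygonalMesh

/-! ## Quadrature rules -/

/-- Apply exactness to the square of `∏_{ν ≠ μ} (X - x_ν)`, of degree `2N - 2`: only the node `μ`
contributes, and the integral is positive. -/
theorem GaussRule.weight_pos {N : ℕ} (g : GaussRule N) (μ : Fin N) : 0 < g.weight μ := by
  classical
  set r : Polynomial ℝ := ∏ ν ∈ Finset.univ.erase μ, (Polynomial.X - Polynomial.C (g.node ν))
    with hr
  have hmonic : r.Monic := Polynomial.monic_prod_of_monic _ _ fun ν _ => Polynomial.monic_X_sub_C _
  have hdeg : (r ^ 2).natDegree < 2 * N := by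
    have h1 : r.natDegree = N - 1 := by
      rw [hr, Polynomial.natDegree_prod_of_monic _ _ fun ν _ => Polynomial.monic_X_sub_C _]
      simp
    have := μ.pos
    rw [Polynomial.natDegree_pow, h1]
    omega
  have hsum := g.exact (r ^ 2) hdeg
  rw [Finset.sum_eq_single μ] at hsum
  · have hpos : 0 < ∫ s in (0 : ℝ)..1, (r ^ 2).eval s := by
      refine intervalIntegral.integral_pos zero_lt_one (r ^ 2).continuous.continuousOn
        (fun s _ => by rw [Polynomial.eval_pow]; positivity) ?_
      by_contra! h
      have hinf : Set.Infinite (Set.Icc (0 : ℝ) 1) := Set.Icc_infinite zero_lt_one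
      refine hmonic.ne_zero (Polynomial.eq_zero_of_infinite_isRoot r (hinf.mono fun s hs => ?_))
      have h1 := h s hs
      rw [Polynomial.eval_pow] at h1
      exact pow_eq_zero_iff two_ne_zero |>.1 (le_antisymm h1 (sq_nonneg _))
    rw [← hsum, Polynomial.eval_pow] at hpos
    exact pos_of_mul_pos_left hpos (sq_nonneg _)
  · intro ν _ hν
    have : r.eval (g.node ν) = 0 := by
      rw [hr, Polynomial.eval_prod]
      exact Finset.prod_eq_zero (Finset.mem_erase.2 ⟨hν, Finset.mem_univ _⟩) (by simp)
    simp [Polynomial.eval_pow, this]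
  · simp

theorem PolygonalMesh.sum_weight_evalAt_gaussPoint {Ω : Set Plane} {C E : Type*}
    (T : PolygonalMesh Ω C E) {k : ℕ} (g : GaussRule (k + 1)) (e : E)
    {p : MvPolynomial (Fin 2) ℝ} (hp : p.totalDegree ≤ k) :
    ∑ μ, g.weight μ * evalAt p (T.gaussPoint g e μ) =
      ∫ s in (0 : ℝ)..1, evalAt p (T.src e + s • (T.tgt e - T.src e)) := by
  obtain ⟨c, hc⟩ : ∃ c : Fin 2 → Polynomial ℝ, c = fun i =>
    Polynomial.C (T.src e i) + Polynomial.X * Polynomial.C (T.tgt e i - T.src e i) := ⟨_, rfl⟩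
  obtain ⟨r, hr⟩ : ∃ r : Polynomial ℝ, r = MvPolynomial.aeval c p := ⟨_, rfl⟩
  have heval : ∀ s, r.eval s = evalAt p (T.src e + s • (T.tgt e - T.src e)) := by
    intro s
    have : ∀ q : Polynomial ℝ, q.eval s = Polynomial.evalRingHom s q := fun _ => rfl
    rw [this, hr, MvPolynomial.aeval_def, MvPolynomial.hom_eval₂, evalAt, MvPolynomial.eval]
    congr 1
    · ext; simp
    · funext i; simp [hc]
  have hdeg : r.natDegree ≤ k := by
    have hlin : ∀ a b : ℝ, (Polynomial.C a + Polynomial.X * Polynomial.C b).natDegree ≤ 1 :=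
      fun a b => by compute_degree
    have hc1 : ∀ i, (c i).natDegree ≤ 1 := fun i => by rw [hc]; exact hlin _ _
    rw [hr]
    simpa using MvPolynomial.aeval_natDegree_le p hp c hc1
  have := g.exact r (by omega)
  simp only [heval] at this
  exact this

theorem MvPolynomial.totalDegree_pderiv_le {σ R : Type*} [CommSemiring R] (p : MvPolynomial σ R)
    (i : σ) : (MvPolynomial.pderiv i p).totalDegree ≤ p.totalDegree := by
  classical
  conv_lhs => rw [p.as_sum, map_sum]
  refine (MvPolynomial.totalDegree_finsetSum _ _).trans (Finset.sup_le fun m hm => ?_)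
  rw [MvPolynomial.pderiv_monomial]
  refine (MvPolynomial.totalDegree_monomial_le _ _).trans ?_
  refine le_trans ?_ (MvPolynomial.le_totalDegree hm)
  exact Finsupp.sum_le_sum_index (tsub_le_self : m - Finsupp.single i 1 ≤ m)
    (fun _ _ => monotone_id) fun _ _ => rfl

/-! ### Cell averages as positive combinations of nodal values. -/

section average

variable {Ω : Set Plane} {C E : Type*} (T : PolygonalMesh Ω C E) {k : ℕ}

theorem DGSpace.totalDegree_le (u : DGSpace C k) (K : C) :
    (u K : MvPolynomial (Fin 2) ℝ).totalDegree ≤ k :=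
  (MvPolynomial.mem_restrictTotalDegree (Fin 2) k _).1 (u K).2

theorem DGState.avg_eq_sum {ι : Type*} {s : Finset ι} {w : ι → ℝ} {x : ι → Plane} {K : C}
    (h : ∀ u : DGSpace C k, u.avg T K = ∑ i ∈ s, w i * u.val K (x i)) (U : DGState C k) :
    U.avg T K = ∑ i ∈ s, w i • U.val K (x i) := by
  refine Prod.ext ?_ (Prod.ext ?_ ?_)
  · simp [DGState.avg, DGState.val, h, Prod.fst_sum]
  · ext l
    rw [Prod.snd_sum, Prod.fst_sum]
    fin_cases l <;> simp [DGState.avg, DGState.val, h]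
  · simp [DGState.avg, DGState.val, h, Prod.snd_sum]

namespace PolygonalMesh

theorem nonempty_interior_cell (K : C) : (interior (T.cell K)).Nonempty :=
  (T.isConnected_interior K).nonempty

theorem area_pos (K : C) : 0 < T.area K :=
  ENNReal.toReal_pos (isOpen_interior.measure_pos volume (T.nonempty_interior_cell K)
    |>.trans_le (measure_mono interior_subset)).ne' (T.isCompact_cell K).measure_lt_top.ne

/-- Without edges the cell would be clopen, hence empty or the whole plane. Nonemptiness supplies
the one strictly admissible summand. -/
theorem edges_nonempty (K : C) : (T.edges K).Nonempty := by
  by_contra h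
  rw [Finset.not_nonempty_iff_eq_empty] at h
  have hf := T.frontier_cell K
  simp only [h, Finset.notMem_empty, Set.iUnion_of_empty, Set.iUnion_empty] at hf
  have hclopen : IsClopen (T.cell K) := isClopen_iff_frontier_eq_empty.2 hf
  rcases isClopen_iff.1 hclopen with h0 | h0
  · have := T.nonempty_interior_cell K
    simp [h0] at this
  · exact noncompact_univ Plane (h0 ▸ T.isCompact_cell K)

theorem edgeLength_pos (e : E) : 0 < T.edgeLength e := dist_pos.2 (T.src_ne_tgt e)

theorem mem_edges_of_neighbour_eq_some {K K' : C} {e : E} (h : T.neighbour K e = some K') :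
    e ∈ T.edges K' := by
  unfold neighbour at h
  split_ifs at h with h0
  rw [← Option.some.inj h]
  exact h0.choose_spec.2

variable {T}

theorem avg_eq_sum_quad {K : C} (q : CellQuadrature (T.cell K) k) (u : DGSpace C k) :
    u.avg T K = ∑ i, q.weight i * u.val K (q.node i) :=
  (q.exact _ (u.totalDegree_le K)).symm

namespace SpecialQuadrature

variable {N : ℕ} {g : GaussRule N} {K : C} (Q : T.SpecialQuadrature g k K)

/-- The index set of all the nodes of the special quadrature. -/
def index : Finset ((E × Fin N) ⊕ Fin Q.size) :=
  (T.edges K ×ˢ Finset.univ).disjSum Finset.univ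

/-- All the weights of the special quadrature. -/
def allWeight : (E × Fin N) ⊕ Fin Q.size → ℝ :=
  Sum.elim (fun i => Q.edgeWeight i.1 i.2) Q.weight

/-- All the nodes of the special quadrature. -/
def allNode : (E × Fin N) ⊕ Fin Q.size → Plane :=
  Sum.elim (fun i => T.gaussPoint g i.1 i.2) Q.node

theorem sum_index {M : Type*} [AddCommMonoid M] (f : (E × Fin N) ⊕ Fin Q.size → M) :
    ∑ i ∈ Q.index, f i =
      ∑ e ∈ T.edges K, ∑ μ, f (Sum.inl (e, μ)) + ∑ q, f (Sum.inr q) := by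
  rw [index, Finset.sum_disjSum, Finset.sum_product]

theorem avg_eq_sum (u : DGSpace C k) :
    u.avg T K = ∑ i ∈ Q.index, Q.allWeight i * u.val K (Q.allNode i) := by
  rw [Q.sum_index]
  exact (Q.exact _ (u.totalDegree_le K)).symm

theorem allWeight_pos {i : (E × Fin N) ⊕ Fin Q.size} (hi : i ∈ Q.index) : 0 < Q.allWeight i := by
  rcases i with ⟨e, μ⟩ | q
  · have : e ∈ T.edges K := by simpa [index] using hi
    exact Q.edgeWeight_pos e this μ
  · exact Q.weight_pos q

theorem index_nonempty (hN : 0 < N) : Q.index.Nonempty := by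
  obtain ⟨e, he⟩ := T.edges_nonempty K
  exact ⟨Sum.inl (e, ⟨0, hN⟩), by simp [index, he]⟩

theorem avg_pos (hN : 0 < N) {u : DGSpace C k} (hu : ∀ i ∈ Q.index, 0 < u.val K (Q.allNode i)) :
    0 < u.avg T K := by
  rw [Q.avg_eq_sum]
  exact Finset.sum_pos (fun i hi => mul_pos (Q.allWeight_pos hi) (hu i hi)) (Q.index_nonempty hN)

theorem avg_mem_G (hN : 0 < N) {U : DGState C k}
    (hU : ∀ i ∈ Q.index, U.val K (Q.allNode i) ∈ Euler.G) : U.avg T K ∈ Euler.G := by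
  rw [DGState.avg_eq_sum T Q.avg_eq_sum]
  exact Euler.sum_mem_G (Q.index_nonempty hN)
    fun i hi => Euler.smul_mem_G (Q.allWeight_pos hi) (hU i hi)

end SpecialQuadrature

/-- The discrete divergence theorem for the cell quadrature and the Gauss rule. -/
theorem area_smul_sum_gradAt {K : C} (q : CellQuadrature (T.cell K) k) (g : GaussRule (k + 1))
    {p : MvPolynomial (Fin 2) ℝ} (hp : p.totalDegree ≤ k) :
    T.area K • ∑ i, q.weight i • gradAt p (q.node i) =
      ∑ e ∈ T.edges K,
        (T.edgeLength e * ∑ μ, g.weight μ * evalAt p (T.gaussPoint g e μ)) • T.normal K e := by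
  have hgrad : ∀ x l, gradAt p x l = evalAt (MvPolynomial.pderiv l p) x := by
    intro x l
    fin_cases l <;> rfl
  ext l
  simp only [PiLp.smul_apply, WithLp.ofLp_sum, Finset.sum_apply, smul_eq_mul, hgrad]
  rw [q.exact _ ((MvPolynomial.totalDegree_pderiv_le p l).trans hp), setAverage_eq, smul_eq_mul,
    T.setIntegral_pderiv, ← area, mul_inv_cancel_left₀ (T.area_pos K).ne']
  refine Finset.sum_congr rfl fun e _ => ?_
  rw [T.sum_weight_evalAt_gaussPoint g e hp]
  ring

end PolygonalMesh

end average

/-! ### The scheme tested with `v = 1`. -/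

theorem evalAt_one (x : Plane) : evalAt 1 x = 1 := by simp [evalAt]

theorem gradAt_one (x : Plane) : gradAt 1 x = 0 := by
  ext l
  fin_cases l <;> simp [gradAt, evalAt]

namespace Euler

theorem flux_zero (γ : ℝ) (U : State) : flux γ U 0 = 0 := by simp [flux]

theorem accelerate_smul (U : State) (c : ℝ) (a : Plane) :
    accelerate U (c • a) = c • accelerate U a := by
  simp [accelerate, smul_comm c, real_inner_smul_right]

end Euler

namespace WBScheme

open Euler

variable {Ω : Set Plane} {C E : Type*} {T : PolygonalMesh Ω C E} {k : ℕ} (S : WBScheme T k)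

/-- The sum of the jumps of the equilibrium pressure over the boundary of `K`. -/
def jumpSum (K : C) : Plane :=
  ∑ e ∈ T.edges K, (T.edgeLength e * ∑ μ, S.gauss.weight μ * S.peJump K e μ) • T.normal K e

/-- Write `p⋆` as interior trace plus half the jump, and apply the discrete divergence theorem to
the interior traces. -/
theorem sourceBracket_one (K : C) :
    S.sourceBracket K 1 =
      T.area K • ∑ q, (S.quad K).weight q • S.pe.grad K ((S.quad K).node q)
        + (1 / 2 : ℝ) • S.jumpSum K := by
  have h := PolygonalMesh.area_smul_sum_gradAt (S.quad K) S.gauss (S.pe.totalDegree_le K)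
  simp only [DGSpace.grad]
  rw [h, jumpSum, Finset.smul_sum, ← Finset.sum_add_distrib, sourceBracket]
  simp only [evalAt_one, gradAt_one, smul_zero, Finset.sum_const_zero, sub_zero, mul_one]
  refine Finset.sum_congr rfl fun e _ => ?_
  rw [← Finset.sum_smul, smul_smul, smul_smul, ← add_smul, mul_left_comm, ← mul_add,
    Finset.mul_sum _ _ (1 / 2), ← Finset.sum_add_distrib]
  congr 2
  refine Finset.sum_congr rfl fun μ _ => ?_
  simp only [peStar, peJump, peInt, DGSpace.val]
  ring

/-- The volume sum of `∇p_h^e` from the bracket, multiplied by the mean ratio, cancels the mean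
ratio subtracted inside the volume term. Only the jumps still act on the mean state. -/
theorem source_one (U : DGState C k) (K : C) :
    ((0, S.sourceMomentum U K 1, S.sourceEnergy U K 1) : State) =
      T.area K • ∑ q, (S.quad K).weight q • accelerate (U.val K ((S.quad K).node q))
        ((S.ρe.val K ((S.quad K).node q))⁻¹ • S.pe.grad K ((S.quad K).node q))
      + accelerate (U.avg T K) ((2 * S.ρe.avg T K)⁻¹ • S.jumpSum K) := by
  refine Prod.ext ?_ (Prod.ext ?_ ?_)
  · simp [accelerate, Prod.fst_sum]
  · simp only [sourceMomentum, sourceBracket_one, accelerate, Prod.snd_add, Prod.fst_add,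
      Prod.smul_snd, Prod.smul_fst, Prod.snd_sum, Prod.fst_sum, evalAt_one, mul_one, mul_sub,
      sub_smul, Finset.sum_sub_distrib]
    have h : ∑ q, ((S.quad K).weight q * (density (U.avg T K) / S.ρe.avg T K)) •
        S.pe.grad K ((S.quad K).node q) = (density (U.avg T K) / S.ρe.avg T K) •
        ∑ q, (S.quad K).weight q • S.pe.grad K ((S.quad K).node q) := by
      rw [Finset.smul_sum]
      exact Finset.sum_congr rfl fun q _ => by rw [smul_smul, mul_comm]
    rw [h]
    simp only [div_eq_mul_inv, smul_smul, mul_inv]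
    module
  · simp only [sourceEnergy, sourceBracket_one, accelerate, Prod.snd_add,
      Prod.smul_snd, Prod.snd_sum, evalAt_one, mul_one, inner_sub_left, mul_sub,
      Finset.sum_sub_distrib, real_inner_smul_left, real_inner_smul_right, inner_add_right,
      inner_sum, Finset.mul_sum, smul_eq_mul]
    have h : ∀ q, T.area K * ((S.quad K).weight q * ((S.ρe.avg T K)⁻¹ *
        ⟪momentum (U.avg T K), S.pe.grad K ((S.quad K).node q)⟫)) =
        (S.ρe.avg T K)⁻¹ * (T.area K * ((S.quad K).weight q *
        ⟪momentum (U.avg T K), S.pe.grad K ((S.quad K).node q)⟫)) := fun q => by ring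
    simp only [h, ← Finset.mul_sum]
    rw [mul_inv]
    ring

theorem L_eq (U : DGState C k) (UBdry : E → Fin (k + 1) → State) (K : C) :
    S.L U UBdry K =
      ∑ q, (S.quad K).weight q • accelerate (U.val K ((S.quad K).node q))
        ((S.ρe.val K ((S.quad K).node q))⁻¹ • S.pe.grad K ((S.quad K).node q))
      + accelerate (U.avg T K) ((2 * T.area K * S.ρe.avg T K)⁻¹ • S.jumpSum K)
      - ∑ e ∈ T.edges K, ∑ μ, ((T.area K)⁻¹ * T.edgeLength e * S.gauss.weight μ) •
          S.numFlux U UBdry K e μ := by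
  have hA := (T.area_pos K).ne'
  rw [L, rhs, source_one]
  simp only [gradAt_one, flux_zero, smul_zero, Finset.sum_const_zero, zero_add, evalAt_one,
    mul_one, smul_sub, smul_add, Finset.smul_sum, smul_smul]
  congr 2
  · simp only [← mul_assoc, inv_mul_cancel₀ hA, one_mul]
  · rw [← accelerate_smul, smul_smul]
    congr 2
    rw [mul_inv, mul_inv, mul_inv]
    ring
  · simp only [mul_assoc]

section bounds

variable (U : DGState C k) (UBdry : E → Fin (k + 1) → State) (K : C)

theorem alpha_UInt_le_alphaF {e : E} (he : e ∈ T.edges K) (μ : Fin (k + 1)) :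
    alpha S.γ (T.normal K e) (S.UInt U K e μ) ≤ S.alphaF U UBdry K :=
  (le_ciSup (f := fun i : T.edges K × Fin (k + 1) =>
    alpha S.γ (T.normal K i.1) (S.UInt U K i.1 i.2)) (Set.finite_range _).bddAbove
    (⟨e, he⟩, μ)).trans (le_max_left _ _)

theorem alpha_UExt_le_alphaF {e : E} (he : e ∈ T.edges K) (μ : Fin (k + 1)) :
    alpha S.γ (T.normal K e) (S.UExt U UBdry K e μ) ≤ S.alphaF U UBdry K :=
  (le_ciSup (f := fun i : T.edges K × Fin (k + 1) =>
    alpha S.γ (T.normal K i.1) (S.UExt U UBdry K i.1 i.2)) (Set.finite_range _).bddAbove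
    (⟨e, he⟩, μ)).trans (le_max_right _ _)

variable {U UBdry K}

/-- Expanding the mean by the same cell quadrature as the source pairs each acceleration with the
state it acts on. -/
theorem alphaS1_smul_avg_add_mem_closedCone
    (hρe : ∀ q, 0 < S.ρe.val K ((S.quad K).node q))
    (hU : ∀ q, U.val K ((S.quad K).node q) ∈ G) :
    S.alphaS1 U K • U.avg T K
      + ∑ q, (S.quad K).weight q • accelerate (U.val K ((S.quad K).node q))
        ((S.ρe.val K ((S.quad K).node q))⁻¹ • S.pe.grad K ((S.quad K).node q)) ∈ closedCone := by
  rw [DGState.avg_eq_sum T (PolygonalMesh.avg_eq_sum_quad (S.quad K)), Finset.smul_sum,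
    ← Finset.sum_add_distrib]
  refine sum_mem_closedCone fun q _ => ?_
  rw [smul_comm, ← smul_add]
  refine smul_mem_closedCone ((S.quad K).weight_nonneg q)
    (smul_add_accelerate_mem_closedCone (hU q) ?_)
  rw [norm_smul, norm_inv, Real.norm_of_nonneg (hρe q).le, inv_mul_eq_div, div_div]
  exact le_ciSup (f := fun q => ‖S.pe.grad K ((S.quad K).node q)‖ /
    (S.ρe.val K ((S.quad K).node q) * √(2 * specificEnergy (U.val K ((S.quad K).node q)))))
    (Set.finite_range _).bddAbove q

theorem alphaS2_smul_avg_add_mem_closedCone (hρe : 0 < S.ρe.avg T K) (hU : U.avg T K ∈ G) :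
    S.alphaS2 U K • U.avg T K
      + accelerate (U.avg T K) ((2 * T.area K * S.ρe.avg T K)⁻¹ • S.jumpSum K) ∈ closedCone := by
  refine smul_add_accelerate_mem_closedCone hU ?_
  have hA := T.area_pos K
  rw [norm_smul, norm_inv, Real.norm_of_nonneg (by positivity), inv_mul_eq_div, div_div]
  rfl

theorem smul_UInt_sub_numFlux_mem_G (hγ : 1 < S.γ) {e : E} (he : e ∈ T.edges K)
    {μ : Fin (k + 1)} (hpi : 0 < S.peInt K e μ) (hpe : 0 < S.peExt K e μ)
    (hUi : S.UInt U K e μ ∈ G) (hUe : S.UExt U UBdry K e μ ∈ G) :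
    (2 * S.alphaF U UBdry K) • (S.peStar K e μ / S.peInt K e μ) • S.UInt U K e μ
      - S.numFlux U UBdry K e μ ∈ G := by
  have hps : 0 < S.peStar K e μ := by unfold peStar; positivity
  have h1 := div_pos hps hpi
  have h2 := div_pos hps hpe
  refine smul_sub_hllc_mem_G hγ (T.isOutwardNormal K e he).1 (smul_mem_G h1 hUi)
    (smul_mem_G h2 hUe) ?_ ?_
  · rw [alpha_smul hUi h1]; exact S.alpha_UInt_le_alphaF U UBdry K he μ
  · rw [alpha_smul hUe h2]; exact S.alpha_UExt_le_alphaF U UBdry K he μ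

end bounds

end WBScheme

end

/-! ### Admissibility of the updated cell averages. -/

theorem mainTheorem2 {Ω : Set Plane} {C E : Type*} (T : PolygonalMesh Ω C E) (k : ℕ)
    -- the target hydrostatic equilibrium and its projection onto the DG space
    (φ ρ p : Plane → ℝ) (hydrostatic : Euler.IsHydrostatic Ω φ ρ p)
    (P : (Plane → ℝ) → DGSpace C k) (hP : T.IsProjection P)
    -- the scheme
    (S : WBScheme T k) (hγ : 1 < S.γ) (hρe : S.ρe = P ρ) (hpe : S.pe = P p)
    -- the special quadrature
    (Q : ∀ K, T.SpecialQuadrature S.gauss k K)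
    -- the numerical solution, and its exterior states on boundary edges
    (U : DGState C k) (UBdry : E → Fin (k + 1) → State)
    (hequil : ∀ K, ∀ x ∈ S.pointSet (Q K), 0 < S.ρe.val K x ∧ 0 < S.pe.val K x)
    (hU : ∀ K, ∀ x ∈ S.pointSet (Q K), U.val K x ∈ Euler.G)
    (hBdry : ∀ K, ∀ e ∈ T.edges K, T.neighbour K e = none →
      ∀ μ, 0 < S.peBdry e μ ∧ UBdry e μ ∈ Euler.G)
    (Δt : ℝ) (hΔt : 0 < Δt)
    (hCFL : ∀ K, ∀ e ∈ T.edges K, ∀ μ,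
      Δt * (S.alphaF U UBdry K *
            (2 * T.edgeLength e * S.peStar K e μ / (T.area K * S.peInt K e μ))
          + S.alphaS U K * ((Q K).edgeWeight e μ / S.gauss.weight μ))
        ≤ (Q K).edgeWeight e μ / S.gauss.weight μ) :
    ∀ K, U.avg T K + Δt • S.L U UBdry K ∈ Euler.G := by
  intro K
  have hgauss : ∀ K, ∀ e ∈ T.edges K, ∀ μ, T.gaussPoint S.gauss e μ ∈ S.pointSet (Q K) :=
    fun K e he μ => Or.inl (Or.inl ⟨e, he, μ, rfl⟩)
  have hquad : ∀ q, (S.quad K).node q ∈ S.pointSet (Q K) := fun q => Or.inr ⟨q, rfl⟩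
  have hall : ∀ i ∈ (Q K).index, (Q K).allNode i ∈ S.pointSet (Q K) := by
    rintro (⟨e, μ⟩ | q) hi
    · exact hgauss K e (by simpa [PolygonalMesh.SpecialQuadrature.index] using hi) μ
    · exact Or.inl (Or.inr ⟨q, rfl⟩)
  have hpi : ∀ e ∈ T.edges K, ∀ μ, 0 < S.peInt K e μ :=
    fun e he μ => (hequil K _ (hgauss K e he μ)).2
  have hUi : ∀ e ∈ T.edges K, ∀ μ, S.UInt U K e μ ∈ Euler.G :=
    fun e he μ => hU K _ (hgauss K e he μ)
  -- Gauss points depend on the edge alone, so an exterior trace is an interior trace of the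
  -- neighbour at a point of its own node set.
  have hext : ∀ e ∈ T.edges K, ∀ μ, 0 < S.peExt K e μ ∧ S.UExt U UBdry K e μ ∈ Euler.G := by
    intro e he μ
    unfold WBScheme.peExt WBScheme.UExt
    cases h : T.neighbour K e with
    | none => exact hBdry K e he h μ
    | some K' =>
      have hmem := hgauss K' e (T.mem_edges_of_neighbour_eq_some h) μ
      exact ⟨(hequil K' _ hmem).2, hU K' _ hmem⟩
  have hA := T.area_pos K
  have havg : U.avg T K ∈ Euler.G :=
    (Q K).avg_mem_G k.succ_pos fun i hi => hU K _ (hall i hi)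
  have hρavg : 0 < S.ρe.avg T K :=
    (Q K).avg_pos k.succ_pos fun i hi => (hequil K _ (hall i hi)).1
  -- The CFL condition multiplied by `ω_μ`: the share of `U^int` left after the sources covers what
  -- the numerical flux requires.
  have hCFL' : ∀ e ∈ T.edges K, ∀ μ,
      Δt * T.edgeLength e * S.gauss.weight μ / T.area K *
          (2 * S.alphaF U UBdry K * (S.peStar K e μ / S.peInt K e μ))
        ≤ (1 - Δt * S.alphaS U K) * (Q K).edgeWeight e μ := by
    intro e he μ
    have hw := S.gauss.weight_pos μ
    have h := mul_le_mul_of_nonneg_right (hCFL K e he μ) hw.le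
    have h1 := (hpi e he μ).ne'
    have h2 : (Q K).edgeWeight e μ / S.gauss.weight μ * S.gauss.weight μ
        = (Q K).edgeWeight e μ := div_mul_cancel₀ _ hw.ne'
    have h3 : Δt * T.edgeLength e * S.gauss.weight μ / T.area K *
          (2 * S.alphaF U UBdry K * (S.peStar K e μ / S.peInt K e μ))
        = Δt * (S.alphaF U UBdry K *
            (2 * T.edgeLength e * S.peStar K e μ / (T.area K * S.peInt K e μ)))
            * S.gauss.weight μ := by
      field_simp
    rw [h3]
    linear_combination h + (1 - Δt * S.alphaS U K) * h2
  have hκ : ∀ e μ, 0 < Δt * T.edgeLength e * S.gauss.weight μ / T.area K := fun e μ => by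
    have := T.edgeLength_pos e
    have := S.gauss.weight_pos μ
    positivity
  -- At any one Gauss point the left side of `hCFL'` is strictly positive, which forces the
  -- remaining share of the mean to be positive.
  have hc : 0 < 1 - Δt * S.alphaS U K := by
    obtain ⟨e, he⟩ := T.edges_nonempty K
    have hα : 0 < S.alphaF U UBdry K :=
      (Euler.alpha_pos hγ (hUi e he 0)).trans_le (S.alpha_UInt_le_alphaF U UBdry K he 0)
    have h1 := hpi e he 0
    have h2 := (hext e he 0).1
    have hps : 0 < S.peStar K e 0 := by unfold WBScheme.peStar; positivity
    refine pos_of_mul_pos_left (lt_of_lt_of_le (mul_pos (hκ e 0) ?_) (hCFL' e he 0))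
      ((Q K).edgeWeight_pos e he 0).le
    positivity
  have hedge : ∀ e ∈ T.edges K, ∀ μ,
      ((1 - Δt * S.alphaS U K) * (Q K).edgeWeight e μ) • S.UInt U K e μ
        - (Δt * T.edgeLength e * S.gauss.weight μ / T.area K) • S.numFlux U UBdry K e μ
        ∈ Euler.G := by
    intro e he μ
    have h := S.smul_UInt_sub_numFlux_mem_G hγ he (hpi e he μ) (hext e he μ).1 (hUi e he μ)
      (hext e he μ).2
    -- The second summand is the surplus weight of `U^int`, which may vanish when the CFL condition
    -- is sharp.
    have h2 := Euler.add_mem_G (Euler.smul_mem_G (hκ e μ) h) (Euler.smul_mem_closedCone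
      (sub_nonneg.2 (hCFL' e he μ)) (Euler.G_subset_closedCone (hUi e he μ)))
    convert h2 using 1
    module
  have hflux : ∑ e ∈ T.edges K, ∑ μ,
      (((1 - Δt * S.alphaS U K) * (Q K).edgeWeight e μ) • S.UInt U K e μ
        - (Δt * T.edgeLength e * S.gauss.weight μ / T.area K) • S.numFlux U UBdry K e μ)
        ∈ Euler.G :=
    Euler.sum_mem_G (T.edges_nonempty K) fun e he =>
      Euler.sum_mem_G Finset.univ_nonempty fun μ _ => hedge e he μ
  have hint : (1 - Δt * S.alphaS U K) • ∑ q, (Q K).weight q • U.val K ((Q K).node q)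
      ∈ Euler.closedCone :=
    Euler.smul_mem_closedCone hc.le (Euler.sum_mem_closedCone fun q _ =>
      Euler.smul_mem_closedCone ((Q K).weight_pos q).le
        (Euler.G_subset_closedCone (hU K _ (Or.inl (Or.inr ⟨q, rfl⟩)))))
  have hs1 := S.alphaS1_smul_avg_add_mem_closedCone (K := K) (fun q => (hequil K _ (hquad q)).1)
    fun q => hU K _ (hquad q)
  have hs2 := S.alphaS2_smul_avg_add_mem_closedCone hρavg havg
  have htotal := Euler.add_mem_G hflux (Euler.add_mem_closedCone hint
    (Euler.smul_mem_closedCone hΔt.le (Euler.add_mem_closedCone hs1 hs2)))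
  have hsplit : (1 - Δt * S.alphaS U K) • U.avg T K =
      ∑ e ∈ T.edges K, ∑ μ, ((1 - Δt * S.alphaS U K) * (Q K).edgeWeight e μ) • S.UInt U K e μ
      + (1 - Δt * S.alphaS U K) • ∑ q, (Q K).weight q • U.val K ((Q K).node q) := by
    rw [DGState.avg_eq_sum T (Q K).avg_eq_sum, (Q K).sum_index, smul_add]
    simp only [Finset.smul_sum, smul_smul]
    rfl
  have hF : Δt • ∑ e ∈ T.edges K, ∑ μ, ((T.area K)⁻¹ * T.edgeLength e * S.gauss.weight μ) •
          S.numFlux U UBdry K e μ = ∑ e ∈ T.edges K, ∑ μ,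
      (Δt * T.edgeLength e * S.gauss.weight μ / T.area K) • S.numFlux U UBdry K e μ := by
    simp only [Finset.smul_sum, smul_smul]
    refine Finset.sum_congr rfl fun e _ => Finset.sum_congr rfl fun μ _ => ?_
    congr 1
    ring
  convert htotal using 1
  simp only [Finset.sum_sub_distrib]
  rw [S.L_eq, smul_sub, hF]
  -- The three shares of the mean; only the first is then expanded by the special quadrature.
  have hUavg : U.avg T K = (1 - Δt * S.alphaS U K) • U.avg T K
      + Δt • (S.alphaS1 U K • U.avg T K + S.alphaS2 U K • U.avg T K) := by
    rw [WBScheme.alphaS]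
    module
  rw [hsplit] at hUavg
  nth_rewrite 1 [hUavg]
  simp only [smul_add]
  abel
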